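/- Let $CS(\mathbb R)$ be the set of continuous functions $a:\mathbb R\to\mathbb C$ having limits $a(\pm\infty)$ at $+\infty$ and $-\infty$; each such $a$ is regarded as a function on $[-\infty,\infty]$. On $L^2(\mathbb R)$ let $a(M)$ denote the operator of multiplication by $a$, and let $b(D)=F^{-1}b(M)F$, where $F$ is the unitary Fourier transform, $Fu(x)=\frac1{\sqrt{2\pi}}\int_{\mathbb R}e^{-ixt}u(t)\,dt$. Let $\mathcal C$ be the $C^*$-subalgebra of $\mathcal L(L^2(\mathbb R))$ generated by all $a(M)$ and $b(D)$ with $a,b\in CS(\mathbb R)$, let $J$ be its commutator ideal (the smallest closed two-sided ideal of $\mathcal C$ containing all commutators $ST-TS$, $S,T\in\mathcal C$), and let $\mathcal K_{\mathbb R}$ be the set of compact operators on $L^2(\mathbb R)$. The symbol space of $\mathcal C$ is the spectrum of $\mathcal C/J$ (the nonzero multiplicative linear functionals, with the weak-$*$ topology), and the symbol $\sigma_T$ of $T\in\mathcal C$ is the Gelfand transform of the class of $T$ in $\mathcal C/J$. Theorem. (i) $J=\mathcal K_{\mathbb R}$; in particular $\mathcal K_{\mathbb R}\subset\mathcal C$.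 (ii) The symbol space of $\mathcal C$ is homeomorphic to $$M_C=\{(x,\xi)\in[-\infty,\infty]\times[-\infty,\infty] : |x|+|\xi|=\infty\},$$ by a homeomorphism under which, for all $a,b\in CS(\mathbb R)$ and all $(x,\xi)\in M_C$, $$\sigma_{a(M)}(x,\xi)=a(x),\qquad \sigma_{b(D)}(x,\xi)=b(\xi).$$ (iii) With this identification, $T+\mathcal K_{\mathbb R}\mapsto\sigma_T$ is a well-defined isometric $*$-isomorphism of $\mathcal C/\mathcal K_{\mathbb R}$ onto $C(M_C)$. -/

import Mathlib

open MeasureTheory Filter Topology WeakDual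
open scoped ENNReal FourierTransform SchwartzMap ComplexInnerProductSpace InnerProductSpace

noncomputable section

namespace SymbolAlgebra

section Ideals

/-! ### Commutator ideals, symbol spaces and symbols -/

variable (A : Type*) [NormedRing A] [NormedAlgebra ℂ A]

/-- The commutator ideal of `A`: the smallest closed two-sided ideal of `A` which contains all
the commutators `a * b - b * a`. -/
def commutatorIdeal : Ideal A :=
  sInf {I : Ideal A | I.IsTwoSided ∧ IsClosed (I : Set A) ∧ ∀ a b : A, a * b - b * a ∈ I}

instance commutatorIdeal_isTwoSided : (commutatorIdeal A).IsTwoSided where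
  mul_mem_of_left := by
    intro a b ha
    simp only [commutatorIdeal, Submodule.mem_sInf, Set.mem_ofPred_eq] at ha ⊢
    intro I hI
    have := hI.1
    exact Ideal.mul_mem_right b I (ha I hI)

/-- The symbol space of `A`: the spectrum of the quotient of `A` by its commutator ideal, that is,
the nonzero multiplicative linear functionals on this quotient with the weak-* topology. -/
abbrev SymbolSpace : Type _ := characterSpace ℂ (A ⧸ commutatorIdeal A)

variable {A}

/-- The `σ`-symbol: the canonical projection onto the quotient by the commutator ideal, followed by
the Gelfand transform of the quotient. -/
def symbol (T : A) : C(SymbolSpace A, ℂ) :=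
  gelfandTransform ℂ (A ⧸ commutatorIdeal A) (Ideal.Quotient.mk (commutatorIdeal A) T)

end Ideals

section StarQuotient

/-! ### The involution of a quotient by a self-adjoint two-sided ideal -/

variable {A : Type*} [Ring A] [StarRing A]

/-- The ideal `I` is stable under the involution. -/
class IsStarIdeal (I : Ideal A) : Prop where
  star_mem : ∀ {a : A}, a ∈ I → star a ∈ I

variable (I : Ideal A) [I.IsTwoSided] [IsStarIdeal I]

instance instStarQuotient : Star (A ⧸ I) where
  star := Quotient.map' (s₁ := Submodule.quotientRel I) (s₂ := Submodule.quotientRel I) star (by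
    intro a b hab
    rw [Submodule.quotientRel_def] at hab ⊢
    rw [← star_sub]
    exact IsStarIdeal.star_mem hab)

@[simp]
theorem star_mk (a : A) :
    star (Ideal.Quotient.mk I a) = Ideal.Quotient.mk I (star a) := rfl

instance instStarRingQuotient : StarRing (A ⧸ I) where
  star_involutive x := by
    obtain ⟨a, rfl⟩ := Ideal.Quotient.mk_surjective x
    simp
  star_mul x y := by
    obtain ⟨a, rfl⟩ := Ideal.Quotient.mk_surjective x
    obtain ⟨b, rfl⟩ := Ideal.Quotient.mk_surjective y
    rw [← map_mul, star_mk, star_mul, map_mul, star_mk, star_mk]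
  star_add x y := by
    obtain ⟨a, rfl⟩ := Ideal.Quotient.mk_surjective x
    obtain ⟨b, rfl⟩ := Ideal.Quotient.mk_surjective y
    rw [← map_add, star_mk, star_add, map_add, star_mk, star_mk]

end StarQuotient

/-! ### Operators on `L²(ℝ)` -/

/-- The Hilbert space `L²(ℝ)` of complex-valued square-integrable functions. -/
abbrev L2R : Type := Lp ℂ 2 (volume : Measure ℝ)

/-- The bounded operator of multiplication by an essentially bounded function,
`a(M) u (x) = a x * u x`. -/
def mulOp (a : Lp ℂ ∞ (volume : Measure ℝ)) : L2R →L[ℂ] L2R :=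
  (ContinuousLinearMap.mul ℂ ℂ).holderL volume ∞ 2 2 a

theorem mulOp_apply_ae (a : Lp ℂ ∞ (volume : Measure ℝ)) (u : L2R) :
    mulOp a u =ᵐ[volume] fun x => a x * u x :=
  (ContinuousLinearMap.mul ℂ ℂ).coeFn_holder a u

/-- `CS`: the continuous functions from `ℝ` to `ℂ` with limits at `+∞` and at `-∞`. -/
def CS : Set (ℝ → ℂ) :=
  {a | Continuous a ∧ (∃ l, Tendsto a atTop (𝓝 l)) ∧ ∃ l, Tendsto a atBot (𝓝 l)}

/-- The extension of a function in `CS` to `[-∞, ∞]`, by its limits at `±∞`. -/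
def CS.ext (a : CS) (x : EReal) : ℂ :=
  EReal.rec (motive := fun _ => ℂ) (limUnder atBot a.1) a.1 (limUnder atTop a.1) x

theorem CS.ext_coe (a : CS) (x : ℝ) : CS.ext a (x : EReal) = a.1 x := rfl

theorem CS.tendsto_atTop (a : CS) : Tendsto a.1 atTop (𝓝 (CS.ext a ⊤)) :=
  tendsto_nhds_limUnder a.2.2.1

theorem CS.tendsto_atBot (a : CS) : Tendsto a.1 atBot (𝓝 (CS.ext a ⊥)) :=
  tendsto_nhds_limUnder a.2.2.2

theorem CS.memLp (a : CS) : MemLp a.1 ∞ (volume : Measure ℝ) := by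
  obtain ⟨hc, ⟨l, hl⟩, ⟨m, hm⟩⟩ := a.2
  have h1 : ∀ᶠ x in atTop, ‖a.1 x‖ ≤ ‖l‖ + 1 :=
    (hl.norm.eventually (gt_mem_nhds (lt_add_one _))).mono fun _ h => h.le
  have h2 : ∀ᶠ x in atBot, ‖a.1 x‖ ≤ ‖m‖ + 1 :=
    (hm.norm.eventually (gt_mem_nhds (lt_add_one _))).mono fun _ h => h.le
  obtain ⟨R, hR⟩ := eventually_atTop.1 h1
  obtain ⟨S, hS⟩ := eventually_atBot.1 h2
  obtain ⟨C, hC⟩ := (isCompact_Icc (a := S) (b := R)).exists_bound_of_continuousOn hc.continuousOn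
  refine memLp_top_of_bound hc.aestronglyMeasurable
    (max C (max (‖l‖ + 1) (‖m‖ + 1))) (Eventually.of_forall fun x => ?_)
  rcases le_total R x with h | h
  · exact (hR x h).trans ((le_max_left _ _).trans (le_max_right _ _))
  rcases le_total x S with h' | h'
  · exact (hS x h').trans ((le_max_right _ _).trans (le_max_right _ _))
  · exact (hC x ⟨h', h⟩).trans (le_max_left _ _)

/-- The multiplication operator `a(M)` for `a` in `CS`. -/
def multiplication (a : CS) : L2R →L[ℂ] L2R := mulOp (CS.memLp a).toLp

theorem multiplication_apply_ae (a : CS) (u : L2R) :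
    multiplication a u =ᵐ[volume] fun x => a.1 x * u x := by
  filter_upwards [mulOp_apply_ae (CS.memLp a).toLp u, (CS.memLp a).coeFn_toLp] with x h1 h2
  rw [multiplication, h1, h2]

/-! ### The unitary Fourier transform `F u (x) = (2π)^(-1/2) ∫ exp(-ixt) u(t) dt` -/

theorem quasiMeasurePreserving_mul {c : ℝ} (hc : 0 < c) :
    Measure.QuasiMeasurePreserving (fun x : ℝ => c * x) volume volume :=
  ⟨measurable_const_mul c, by
    rw [Real.map_volume_mul_left hc.ne']
    exact Measure.smul_absolutelyContinuous⟩

theorem eLpNorm_dilate {c : ℝ} (hc : 0 < c) {f : ℝ → ℂ}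
    (hf : AEStronglyMeasurable f volume) :
    eLpNorm (fun x => (Real.sqrt c : ℂ) * f (c * x)) 2 volume = eLpNorm f 2 volume := by
  have h1 : eLpNorm (fun x => f (c * x)) 2 volume
      = ENNReal.ofReal (Real.sqrt c)⁻¹ * eLpNorm f 2 volume := by
    have hm := Real.map_volume_mul_left hc.ne'
    have h := eLpNorm_map_measure (p := 2) (μ := (volume : Measure ℝ)) (g := f)
      (f := fun x : ℝ => c * x)
      (by rw [hm]; exact hf.mono_ac Measure.smul_absolutelyContinuous)
      (measurable_const_mul c).aemeasurable
    rw [hm, eLpNorm_smul_measure_of_ne_top (by simp)] at h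
    rw [show (fun x => f (c * x)) = f ∘ fun x => c * x from rfl, ← h, abs_of_pos (inv_pos.2 hc),
      smul_eq_mul, ENNReal.ofReal_rpow_of_pos (inv_pos.2 hc)]
    congr 2
    rw [Real.sqrt_eq_rpow, Real.inv_rpow hc.le]
    norm_num
  have h2 := eLpNorm_const_smul (Real.sqrt c : ℂ) (fun x => f (c * x)) 2 (volume : Measure ℝ)
  have h3 : (Real.sqrt c : ℂ) • (fun x => f (c * x)) = fun x => (Real.sqrt c : ℂ) * f (c * x) := rfl
  have h4 : ‖(Real.sqrt c : ℂ)‖ₑ = ENNReal.ofReal (Real.sqrt c) := by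
    rw [← ofReal_norm, Complex.norm_real, Real.norm_of_nonneg (Real.sqrt_nonneg c)]
  have h5 : 0 < Real.sqrt c := Real.sqrt_pos.2 hc
  rw [h3, h1, h4, ← mul_assoc, ← ENNReal.ofReal_mul h5.le, mul_inv_cancel₀ h5.ne',
    ENNReal.ofReal_one, one_mul] at h2
  exact h2

theorem memLp_dilate {c : ℝ} (hc : 0 < c) (f : L2R) :
    MemLp (fun x => (Real.sqrt c : ℂ) * f (c * x)) 2 volume :=
  ⟨((Lp.aestronglyMeasurable f).comp_quasiMeasurePreserving
      (quasiMeasurePreserving_mul hc)).const_mul _, by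
    rw [eLpNorm_dilate hc (Lp.aestronglyMeasurable f)]
    exact Lp.eLpNorm_lt_top f⟩

/-- The function `x ↦ √c * f (c * x)` of `L²(ℝ)`. -/
def dilateFun {c : ℝ} (hc : 0 < c) (f : L2R) : L2R := (memLp_dilate hc f).toLp

theorem dilateFun_ae {c : ℝ} (hc : 0 < c) (f : L2R) :
    dilateFun hc f =ᵐ[volume] fun x => (Real.sqrt c : ℂ) * f (c * x) :=
  (memLp_dilate hc f).coeFn_toLp

theorem dilateFun_dilateFun {c d : ℝ} (hc : 0 < c) (hd : 0 < d) (h : c * d = 1) (f : L2R) :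
    dilateFun hd (dilateFun hc f) = f := by
  refine Lp.ext ?_
  filter_upwards [dilateFun_ae hd (dilateFun hc f),
    (quasiMeasurePreserving_mul hd).ae (dilateFun_ae hc f)] with x h1 h2
  rw [h1, h2, ← mul_assoc, ← mul_assoc, h, one_mul, ← Complex.ofReal_mul,
    ← Real.sqrt_mul hd.le, mul_comm d c, h, Real.sqrt_one, Complex.ofReal_one, one_mul]

/-- The unitary dilation `f ↦ √c * f (c * ·)` of `L²(ℝ)`, for `c > 0`. -/
def dilation {c : ℝ} (hc : 0 < c) : L2R ≃ₗᵢ[ℂ] L2R where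
  toFun := dilateFun hc
  invFun := dilateFun (inv_pos.2 hc)
  map_add' f g := by
    refine Lp.ext ?_
    filter_upwards [dilateFun_ae hc (f + g), dilateFun_ae hc f, dilateFun_ae hc g,
      Lp.coeFn_add (dilateFun hc f) (dilateFun hc g),
      (quasiMeasurePreserving_mul hc).ae (Lp.coeFn_add f g)] with x h1 h2 h3 h4 h5
    rw [h1, h4, Pi.add_apply, h2, h3, h5, Pi.add_apply, mul_add]
  map_smul' z f := by
    refine Lp.ext ?_
    filter_upwards [dilateFun_ae hc (z • f), dilateFun_ae hc f,
      Lp.coeFn_smul z (dilateFun hc f),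
      (quasiMeasurePreserving_mul hc).ae (Lp.coeFn_smul z f)] with x h1 h2 h3 h4
    simp only [RingHom.id_apply]
    rw [h1, h3, Pi.smul_apply, h2, h4, Pi.smul_apply, smul_eq_mul, smul_eq_mul]
    ring
  left_inv f := dilateFun_dilateFun hc _ (mul_inv_cancel₀ hc.ne') f
  right_inv f := dilateFun_dilateFun _ hc (inv_mul_cancel₀ hc.ne') f
  norm_map' f := by
    change ‖dilateFun hc f‖ = ‖f‖
    rw [dilateFun, Lp.norm_toLp, eLpNorm_dilate hc (Lp.aestronglyMeasurable f), Lp.norm_def]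

/-- The unitary Fourier transform of `L²(ℝ)` in the normalization
`F u (x) = (2π)^(-1/2) ∫ exp(-ixt) u(t) dt`: the transform `∫ exp(-2πixt) u(t) dt` followed by the
dilation which replaces `x` by `x / 2π`. The formula itself is `fourier_schwartz_ae`. -/
def fourier : L2R ≃ₗᵢ[ℂ] L2R :=
  (Lp.fourierTransformₗᵢ ℝ ℂ).trans (dilation (c := (2 * Real.pi)⁻¹) (by positivity))

theorem fourier_schwartz_ae (u : 𝓢(ℝ, ℂ)) :
    fourier (u.toLp 2) =ᵐ[volume] fun x =>
      (1 / Real.sqrt (2 * Real.pi) : ℂ) *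
        ∫ t : ℝ, Complex.exp (-Complex.I * x * t) * u t := by
  have hc : (0 : ℝ) < (2 * Real.pi)⁻¹ := by positivity
  have h0 : fourier (u.toLp 2) = dilateFun hc ((𝓕 u).toLp 2) := by
    rw [← SchwartzMap.toLp_fourier_eq]; rfl
  rw [h0]
  filter_upwards [dilateFun_ae hc ((𝓕 u).toLp 2),
    (quasiMeasurePreserving_mul hc).ae ((𝓕 u).coeFn_toLp 2 volume)] with x h1 h2
  rw [h1, h2, SchwartzMap.fourier_coe, Real.fourier_eq', Real.sqrt_inv, Complex.ofReal_inv,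
    one_div]
  congr 1
  refine integral_congr_ae (Eventually.of_forall fun t => ?_)
  have hpi : (Real.pi : ℂ) ≠ 0 := Complex.ofReal_ne_zero.2 Real.pi_ne_zero
  simp only [smul_eq_mul, RCLike.inner_apply, conj_trivial]
  congr 2
  push_cast
  field_simp

/-- The Fourier multiplier `b(D) = F⁻¹ b(M) F` for `b` in `CS`. -/
def fourierMultiplier (b : CS) : L2R →L[ℂ] L2R :=
  (fourier.symm.toContinuousLinearEquiv : L2R →L[ℂ] L2R) ∘L multiplication b ∘L
    (fourier.toContinuousLinearEquiv : L2R →L[ℂ] L2R)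

theorem fourierMultiplier_apply (b : CS) (u : L2R) :
    fourierMultiplier b u = fourier.symm (multiplication b (fourier u)) := rfl

/-! ### The algebra generated by the operators `a(M)` and `b(D)` -/

/-- The `C*`-subalgebra of the bounded operators of `L²(ℝ)` generated by the operators `a(M)` and
`b(D)` with `a` and `b` in `CS`. -/
def algC : StarSubalgebra ℂ (L2R →L[ℂ] L2R) :=
  (StarAlgebra.adjoin ℂ (Set.range multiplication ∪ Set.range fourierMultiplier)).topologicalClosure

/-- `a(M)` as an element of the algebra. -/
def multC (a : CS) : algC :=
  ⟨multiplication a, StarSubalgebra.le_topologicalClosure _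
    (StarAlgebra.subset_adjoin ℂ _ (Or.inl ⟨a, rfl⟩))⟩

/-- `b(D)` as an element of the algebra. -/
def fourC (b : CS) : algC :=
  ⟨fourierMultiplier b, StarSubalgebra.le_topologicalClosure _
    (StarAlgebra.subset_adjoin ℂ _ (Or.inr ⟨b, rfl⟩))⟩

/-- The adjoint of a compact operator of a Hilbert space is compact. -/
theorem isCompactOperator_star {H : Type*} [NormedAddCommGroup H] [InnerProductSpace ℂ H]
    [CompleteSpace H] {T : H →L[ℂ] H} (hT : IsCompactOperator T) :
    IsCompactOperator (star T : H →L[ℂ] H) := by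
  have hS : IsCompactOperator (T * star T : H →L[ℂ] H) := hT.comp_clm (star T)
  refine (isCompactOperator_iff_isCompact_closure_image_closedBall
    ((star T : H →L[ℂ] H) : H →ₗ[ℂ] H) zero_lt_one).2 ?_
  have htb : TotallyBounded ((T * star T : H →L[ℂ] H) '' Metric.closedBall 0 1) :=
    (IsCompactOperator.isCompact_closure_image_closedBall
      (f := ((T * star T : H →L[ℂ] H) : H →ₗ[ℂ] H)) hS 1).totallyBounded.subset subset_closure
  refine isCompact_iff_totallyBounded_isComplete.2
    ⟨TotallyBounded.closure ?_, isClosed_closure.isComplete⟩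
  refine Metric.totallyBounded_iff.2 fun ε hε => ?_
  obtain ⟨t, hts, htf, ht⟩ := Metric.finite_approx_of_totallyBounded htb (ε ^ 2 / 2) (by positivity)
  have hts' : ∀ y ∈ t, ∃ x ∈ Metric.closedBall (0 : H) 1, (T * star T : H →L[ℂ] H) x = y :=
    fun y hy => hts hy
  choose! g hg hgt using hts'
  refine ⟨(fun y => star T (g y)) '' t, htf.image _, ?_⟩
  rintro _ ⟨x, hx, rfl⟩
  obtain ⟨y, hy, hxy⟩ := Set.mem_iUnion₂.1 (ht ⟨x, hx, rfl⟩)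
  refine Set.mem_iUnion₂.2 ⟨_, ⟨y, hy, rfl⟩, ?_⟩
  rw [Metric.mem_ball, dist_eq_norm] at hxy ⊢
  have hz : ‖x - g y‖ ≤ 2 := by
    have h1 : ‖x‖ ≤ 1 := by simpa using hx
    have h2 : ‖g y‖ ≤ 1 := by simpa using hg y hy
    exact (norm_sub_le _ _).trans (by linarith)
  have hv : ‖(T * star T : H →L[ℂ] H) (x - g y)‖ < ε ^ 2 / 2 := by
    rw [map_sub, hgt y hy]; exact hxy
  have hsq : ‖(star T : H →L[ℂ] H) (x - g y)‖ ^ 2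
      ≤ ‖(T * star T : H →L[ℂ] H) (x - g y)‖ * ‖x - g y‖ := by
    have h3 := ContinuousLinearMap.apply_norm_sq_eq_inner_adjoint_left
      (star T : H →L[ℂ] H) (x - g y)
    rw [h3, ContinuousLinearMap.star_eq_adjoint, ContinuousLinearMap.adjoint_adjoint]
    exact re_inner_le_norm _ _
  have hlt : ‖(star T : H →L[ℂ] H) (x - g y)‖ ^ 2 < ε ^ 2 := by
    nlinarith [norm_nonneg ((T * star T : H →L[ℂ] H) (x - g y)), norm_nonneg (x - g y)]
  have := lt_of_pow_lt_pow_left₀ 2 hε.le hlt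
  rw [map_sub] at this
  exact this

/-- The ideal of the algebra formed by its compact operators. -/
def compactIdeal : Ideal algC where
  carrier := {T | IsCompactOperator (T : L2R →L[ℂ] L2R)}
  add_mem' hS hT := hS.add hT
  zero_mem' := isCompactOperator_zero
  smul_mem' S _ hT := hT.clm_comp (S : L2R →L[ℂ] L2R)

theorem mem_compactIdeal {T : algC} :
    T ∈ compactIdeal ↔ IsCompactOperator (T : L2R →L[ℂ] L2R) := Iff.rfl

instance compactIdeal_isTwoSided : compactIdeal.IsTwoSided where
  mul_mem_of_left := fun {S} T hS => IsCompactOperator.comp_clm (f := (S : L2R →L[ℂ] L2R)) hS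
    (T : L2R →L[ℂ] L2R)

instance compactIdeal_isStarIdeal : IsStarIdeal compactIdeal where
  star_mem := fun {S} hS => isCompactOperator_star (T := (S : L2R →L[ℂ] L2R)) hS

/-- The set of the points `(x, ξ)` of `[-∞, ∞] × [-∞, ∞]` with `|x| + |ξ| = ∞`. -/
def MC : Set (EReal × EReal) := {p | p.1.abs + p.2.abs = ⊤}

theorem EReal_abs_eq_top (x : EReal) : x.abs = ⊤ ↔ x = ⊤ ∨ x = ⊥ := by
  induction x with
  | bot => simp
  | top => simp
  | coe x => simp [(EReal.abs_coe_lt_top x).ne]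

theorem isClosed_MC : IsClosed MC := by
  have h : MC = (Prod.fst ⁻¹' {⊤, ⊥} ∪ Prod.snd ⁻¹' {⊤, ⊥} : Set (EReal × EReal)) := by
    ext p
    simp [MC, EReal_abs_eq_top]
  have hf : IsClosed ({⊤, ⊥} : Set EReal) := (Set.toFinite _).isClosed
  rw [h]
  exact (hf.preimage continuous_fst).union (hf.preimage continuous_snd)

instance compactSpace_MC : CompactSpace MC := isCompact_iff_compactSpace.1 isClosed_MC.isCompact

end SymbolAlgebra

end

open SymbolAlgebra

/-! Functions in $CS$ are treated as elements of $C([-\infty,\infty])$, so that $a\mapsto a(M)$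
(`mulHom`) and $b\mapsto b(D)$ (`fourHom`) become continuous $*$-representations of the functions on
a compact space.

Commutators are compact. For $f,g$ square-integrable and $b$ integrable, $f(M)b(D)g(M)$ is a Bochner
integral of rank one operators (`mulHom_mul_fourHom_mul_mulHom`). Hence $b(D)a(M)$ and $a(M)b(D)$
are compact as soon as $a$ and $b$ vanish at $\pm\infty$. By Stone-Weierstrass $\arctan$ generates
$C([-\infty,\infty])$, so the general commutator reduces to that of $\arctan M$ and $\arctan D$.
Replacing $\arctan x$ by $\arctan(rx)$ changes it by a function vanishing at $\pm\infty$, while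
commutators with $\arctan(rM)$ or $\arctan(rD)$ have norm $O(r)$ (`norm_commutator_arctan_le`). This
gives $J\subset\mathcal K$.

Compact operators lie in $J$. If a cutoff $a$ is $1$ on the support of $f$ and $0$ on that of $g$,
then $f(M)b(D)g(M)=f(M)[a(M),b(D)]g(M)\in J$. Letting $b$ concentrate at $0$ produces a rank one
operator. Products of two such operators, together with density, give all operators of rank one.

The quotient. Finite-dimensional projections lie in the algebra and give the C*-identity for the
quotient norm (`norm_mk_mul_norm_mk_le`), so $\mathcal C/J$ is a commutative C*-algebra and Gelfand
theory applies. A character restricts to point evaluations on the two families of generators, hence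
yields a pair $(x,\xi)$ which determines it. Compactness of $a(M)b(D)$ for $a,b$ vanishing at
$\pm\infty$ forces $(x,\xi)\in M_C$. Conversely, a point of $M_C$ that were missed would give a
compact $a(M)b(D)$ with one factor nonzero at infinity and the other not identically zero; this is
excluded because translates tend weakly to zero while $b(D)$ commutes with them
(`eq_zero_of_isCompactOperator_mulHom_mul'`). -/

noncomputable section

namespace SymbolAlgebra

section CompactOperators

/-! ### Compact operators of a Hilbert space -/

open InnerProductSpace

variable {H : Type*} [NormedAddCommGroup H] [InnerProductSpace ℂ H]

/-- A compact operator is almost unchanged by the projection onto some finite-dimensional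
subspace. -/
theorem exists_norm_sub_starProjection_comp_le {T : H →L[ℂ] H} (hT : IsCompactOperator T) {ε : ℝ}
    (hε : 0 < ε) :
    ∃ (V : Submodule ℂ H) (_ : FiniteDimensional ℂ V), ‖T - V.starProjection ∘L T‖ ≤ ε := by
  have htb : TotallyBounded (T '' Metric.closedBall 0 1) :=
    (IsCompactOperator.isCompact_closure_image_closedBall
      (f := (T : H →ₗ[ℂ] H)) hT 1).totallyBounded.subset subset_closure
  obtain ⟨t, -, htf, ht⟩ := Metric.finite_approx_of_totallyBounded htb ε hε
  have : FiniteDimensional ℂ (Submodule.span ℂ t) := FiniteDimensional.span_of_finite ℂ htf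
  refine ⟨Submodule.span ℂ t, this, ContinuousLinearMap.opNorm_le_of_unit_norm hε.le fun x hx => ?_⟩
  obtain ⟨y, hy, hxy⟩ := Set.mem_iUnion₂.1 (ht ⟨x, by simp [hx], rfl⟩)
  rw [Metric.mem_ball, dist_eq_norm] at hxy
  have h1 : ‖T x - (Submodule.span ℂ t).starProjection (T x)‖ ≤ ‖T x - y‖ := by
    rw [Submodule.starProjection_minimal]
    exact ciInf_le ⟨0, by rintro _ ⟨z, rfl⟩; exact norm_nonneg _⟩
      (⟨y, Submodule.subset_span hy⟩ : Submodule.span ℂ t)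
  exact h1.trans hxy.le

theorem isCompactOperator_starProjection (V : Submodule ℂ H) [FiniteDimensional ℂ V] :
    IsCompactOperator V.starProjection :=
  (isCompactOperator_of_locallyCompactSpace_dom V.orthogonalProjectionOnto).clm_comp V.subtypeL

theorem isCompactOperator_rankOne (x y : H) : IsCompactOperator (rankOne ℂ x y) :=
  (isCompactOperator_of_locallyCompactSpace_dom (innerSL ℂ y)).clm_comp
    (ContinuousLinearMap.toSpanSingleton ℂ x)

variable [CompleteSpace H]

/-- The adjoint is compact as well; taking adjoints in its approximation moves the projection to the
right. -/
theorem exists_norm_sub_comp_starProjection_le {T : H →L[ℂ] H} (hT : IsCompactOperator T) {ε : ℝ}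
    (hε : 0 < ε) :
    ∃ (V : Submodule ℂ H) (_ : FiniteDimensional ℂ V), ‖T - T * V.starProjection‖ ≤ ε := by
  obtain ⟨V, hV, h⟩ := exists_norm_sub_starProjection_comp_le (isCompactOperator_star hT) hε
  refine ⟨V, hV, ?_⟩
  rw [← norm_star, star_sub, star_mul,
    show star V.starProjection = V.starProjection from isSelfAdjoint_starProjection V]
  exact h

/-- A closed subspace of operators which contains all rank one operators contains the compact
operators. -/
theorem mem_of_rankOne_mem {S : Submodule ℂ (H →L[ℂ] H)} (hS : IsClosed (S : Set (H →L[ℂ] H)))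
    (h : ∀ x y, rankOne ℂ x y ∈ S) {T : H →L[ℂ] H} (hT : IsCompactOperator T) : T ∈ S := by
  refine hS.closure_subset (Metric.mem_closure_iff.2 fun ε hε => ?_)
  obtain ⟨V, hV, hVT⟩ := exists_norm_sub_starProjection_comp_le hT (half_pos hε)
  refine ⟨V.starProjection ∘L T, ?_, ?_⟩
  · rw [(stdOrthonormalBasis ℂ V).starProjection_eq_sum_rankOne, ContinuousLinearMap.finsetSum_comp]
    refine S.sum_mem fun i _ => ?_
    rw [rankOne_comp]
    exact h _ _
  · rw [dist_eq_norm]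
    exact hVT.trans_lt (half_lt_self hε)

/-- With $Q=1-P$, the C*-identity gives $\|TQ\|^2=\|QT^*TQ\|\le\|T^*TQ\|$. This passes from $T^*T$
to $T$, both for compactness and for the C*-identity of the quotient. -/
theorem norm_sub_comp_starProjection_sq_le (T : H →L[ℂ] H) (V : Submodule ℂ H)
    [V.HasOrthogonalProjection] :
    ‖T - T * V.starProjection‖ ^ 2 ≤ ‖star T * T - star T * T * V.starProjection‖ := by
  have h1 : ‖(1 - V.starProjection : H →L[ℂ] H)‖ ≤ 1 := by
    rw [show (1 - V.starProjection : H →L[ℂ] H) = Vᗮ.starProjection from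
      (Submodule.starProjection_orthogonal' V).symm]
    exact Submodule.starProjection_norm_le _
  have h2 : star (T - T * V.starProjection) * (T - T * V.starProjection)
      = (1 - V.starProjection) * (star T * T - star T * T * V.starProjection) := by
    rw [star_sub, star_mul,
      show star V.starProjection = V.starProjection from isSelfAdjoint_starProjection V]
    noncomm_ring
  rw [sq, ← CStarRing.norm_star_mul_self, h2]
  exact (norm_mul_le _ _).trans (mul_le_of_le_one_left (norm_nonneg _) h1)

/-- A projection $P$ that almost preserves $T^*T$ on the right almost preserves $T$ too, so $T$ is a
norm limit of the compact operators $TP$. -/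
theorem isCompactOperator_of_star_mul_self {T : H →L[ℂ] H}
    (hT : IsCompactOperator (star T * T : H →L[ℂ] H)) : IsCompactOperator T := by
  have hcl : IsClosed {T : H →L[ℂ] H | IsCompactOperator T} := isClosed_setOfPred_isCompactOperator
  refine hcl.closure_subset (Metric.mem_closure_iff.2 fun ε hε => ?_)
  obtain ⟨V, hV, hVT⟩ := exists_norm_sub_comp_starProjection_le hT
    (show 0 < ε ^ 2 / 2 by positivity)
  refine ⟨T * V.starProjection, (isCompactOperator_starProjection V).clm_comp T, ?_⟩
  rw [dist_eq_norm]
  refine lt_of_pow_lt_pow_left₀ 2 hε.le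
    (((norm_sub_comp_starProjection_sq_le T V).trans hVT).trans_lt ?_)
  exact half_lt_self (by positivity)

/-- A compact operator maps bounded weakly null nets to norm null nets. -/
theorem tendsto_of_isCompactOperator {ι : Type*} {l : Filter ι} {T : H →L[ℂ] H}
    (hT : IsCompactOperator T) {u : ι → H} {C : ℝ} (hu : ∀ i, ‖u i‖ ≤ C)
    (h : ∀ v, Tendsto (fun i => ⟪v, u i⟫) l (𝓝 0)) : Tendsto (fun i => T (u i)) l (𝓝 0) := by
  rw [tendsto_zero_iff_norm_tendsto_zero]
  refine Metric.tendsto_nhds.2 fun ε hε => ?_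
  -- Using $|C|+1$ keeps the denominator positive. The part of `u i` orthogonal to `V` then
  -- contributes at most $\varepsilon/2$, and on `V` weak and norm convergence agree.
  set δ := ε / (2 * (|C| + 1)) with hδ
  have hδ0 : 0 < δ := by positivity
  obtain ⟨V, hV, hVT⟩ := exists_norm_sub_comp_starProjection_le hT hδ0
  have h1 : Tendsto (fun i => T (V.starProjection (u i))) l (𝓝 0) := by
    rw [(stdOrthonormalBasis ℂ V).starProjection_eq_sum_rankOne]
    simp only [sum_apply, rankOne_apply, map_sum, map_smul]
    rw [← Finset.sum_const_zero (s := Finset.univ (α := Fin (Module.finrank ℂ V)))]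
    refine tendsto_finsetSum _ fun j _ => ?_
    simpa using (h ((stdOrthonormalBasis ℂ V j : V) : H)).smul_const
      (T ((stdOrthonormalBasis ℂ V j : V) : H))
  filter_upwards [Metric.tendsto_nhds.1 h1 (ε / 2) (half_pos hε)] with i hi
  rw [dist_zero_right] at hi
  rw [dist_zero_right, norm_norm]
  have h2 : ‖(T - T * V.starProjection) (u i)‖ ≤ ε / 2 := by
    refine (ContinuousLinearMap.le_of_opNorm_le_of_le _ hVT ((hu i).trans
      ((le_abs_self C).trans (le_add_of_nonneg_right zero_le_one)))).trans (le_of_eq ?_)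
    rw [hδ]; field_simp
  have h3 : T (u i) = (T - T * V.starProjection) (u i) + T (V.starProjection (u i)) := by simp
  rw [h3]
  exact (norm_add_le _ _).trans_lt (by linarith)

end CompactOperators

section QuotientCStar

/-! ### Commutative quotients of C*-algebras -/

variable {A : Type*} [CStarAlgebra A] (I : Ideal A) [I.IsTwoSided]

/-- Multiply lifts whose norms exceed the quotient norms by less than $\varepsilon$, and let
$\varepsilon\to0$. -/
theorem norm_quotient_mk_mul_le (x y : A ⧸ I) : ‖x * y‖ ≤ ‖x‖ * ‖y‖ := by
  refine le_of_forall_gt_imp_ge_of_dense fun c hc => ?_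
  have h1 : Tendsto (fun ε : ℝ => (‖x‖ + ε) * (‖y‖ + ε)) (𝓝[>] 0) (𝓝 (‖x‖ * ‖y‖)) := by
    have : Tendsto (fun ε : ℝ => (‖x‖ + ε) * (‖y‖ + ε)) (𝓝 0) (𝓝 ((‖x‖ + 0) * (‖y‖ + 0))) :=
      Continuous.tendsto (by fun_prop) 0
    simp only [add_zero] at this
    exact this.mono_left nhdsWithin_le_nhds
  obtain ⟨ε, hεc, hε⟩ := ((h1.eventually (gt_mem_nhds hc)).and self_mem_nhdsWithin).exists
  obtain ⟨a, rfl, ha⟩ := Submodule.Quotient.norm_mk_lt x hε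
  obtain ⟨b, rfl, hb⟩ := Submodule.Quotient.norm_mk_lt y hε
  refine le_trans ?_ hεc.le
  refine (Submodule.Quotient.norm_mk_le I (a * b)).trans ((norm_mul_le a b).trans ?_)
  gcongr

variable [IsStarIdeal I]

/-- A commutative quotient of a C*-algebra as a C*-algebra, given the C*-identity for the quotient
norm. -/
noncomputable abbrev quotientCommCStarAlgebra (hI : IsClosed (I : Set A)) (hcomm : ∀ a b, a * b - b * a ∈ I)
    (hstar : ∀ a : A, ‖Ideal.Quotient.mk I a‖ * ‖Ideal.Quotient.mk I a‖
      ≤ ‖Ideal.Quotient.mk I (star a * a)‖) : CommCStarAlgebra (A ⧸ I) :=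
  let _ : NormedAddCommGroup (A ⧸ I) := Submodule.Quotient.normedAddCommGroup I (hS := hI)
  { (inferInstance : Ring (A ⧸ I)), (inferInstance : NormedAddCommGroup (A ⧸ I)),
    (inferInstance : Algebra ℂ (A ⧸ I)), (inferInstance : StarRing (A ⧸ I)),
    (inferInstance : CompleteSpace (A ⧸ I)) with
    norm_mul_le := norm_quotient_mk_mul_le I
    dist_eq := dist_eq_norm_neg_add
    mul_comm := by
      intro x y
      obtain ⟨a, rfl⟩ := Ideal.Quotient.mk_surjective x
      obtain ⟨b, rfl⟩ := Ideal.Quotient.mk_surjective y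
      rw [← map_mul, ← map_mul]
      exact Ideal.Quotient.eq.2 (hcomm a b)
    norm_smul_le := fun c x => norm_smul_le (α := ℂ) c x
    norm_mul_self_le := by
      intro x
      obtain ⟨a, rfl⟩ := Ideal.Quotient.mk_surjective x
      exact hstar a
    star_smul := by
      intro c x
      obtain ⟨a, rfl⟩ := Ideal.Quotient.mk_surjective x
      change star (Ideal.Quotient.mk I (c • a)) = Ideal.Quotient.mk I (star c • star a)
      rw [star_mk, star_smul] }

end QuotientCStar

end SymbolAlgebra

namespace SymbolAlgebra

section Multiplication

/-! ### Multiplication operators -/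

/-- The restriction to `ℝ` of a continuous function on `[-∞, ∞]`. -/
def CS.ofC (f : C(EReal, ℂ)) : CS :=
  ⟨fun x => f x, f.continuous.comp continuous_coe_real_ereal,
    ⟨_, (f.continuous.tendsto ⊤).comp EReal.tendsto_coe_atTop⟩,
    ⟨_, (f.continuous.tendsto ⊥).comp EReal.tendsto_coe_atBot⟩⟩

theorem CS.continuous_ext (a : CS) : Continuous (CS.ext a) := by
  refine continuous_iff_continuousAt.2 fun x => ?_
  induction x with
  | coe x =>
    rw [ContinuousAt, EReal.nhds_coe, tendsto_map'_iff]
    exact a.2.1.tendsto x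
  | top =>
    rw [continuousAt_iff_punctured_nhds, EReal.nhdsWithin_top, tendsto_map'_iff]
    exact CS.tendsto_atTop a
  | bot =>
    rw [continuousAt_iff_punctured_nhds, EReal.nhdsWithin_bot, tendsto_map'_iff]
    exact CS.tendsto_atBot a

/-- The extension of a function in `CS` to `[-∞, ∞]` as a continuous function. -/
def CS.toC (a : CS) : C(EReal, ℂ) := ⟨CS.ext a, CS.continuous_ext a⟩

theorem denseRange_coe_EReal : DenseRange ((↑) : ℝ → EReal) := by
  intro x
  induction x with
  | coe x => exact subset_closure ⟨x, rfl⟩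
  | top => exact mem_closure_of_tendsto EReal.tendsto_coe_atTop (Eventually.of_forall fun x => ⟨x, rfl⟩)
  | bot => exact mem_closure_of_tendsto EReal.tendsto_coe_atBot (Eventually.of_forall fun x => ⟨x, rfl⟩)

theorem norm_mulOp_le {a : ℝ → ℂ} (ha : MemLp a ∞ volume) {C : ℝ} (hC : 0 ≤ C)
    (h : ∀ x, ‖a x‖ ≤ C) : ‖mulOp ha.toLp‖ ≤ C := by
  refine ContinuousLinearMap.opNorm_le_bound _ hC fun u => ?_
  refine Lp.norm_le_mul_norm_of_ae_le_mul ?_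
  filter_upwards [mulOp_apply_ae ha.toLp u, ha.coeFn_toLp] with x h1 h2
  rw [h1, h2, norm_mul]
  gcongr
  exact h x

theorem mulOp_toLp_ae {a : ℝ → ℂ} (ha : MemLp a ∞ volume) (u : L2R) :
    mulOp ha.toLp u =ᵐ[volume] fun x => a x * u x := by
  filter_upwards [mulOp_apply_ae ha.toLp u, ha.coeFn_toLp] with x h1 h2
  rw [h1, h2]

theorem norm_multiplication_le (a : CS) {C : ℝ} (hC : 0 ≤ C) (h : ∀ x, ‖a.1 x‖ ≤ C) :
    ‖multiplication a‖ ≤ C :=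
  norm_mulOp_le (CS.memLp a) hC h

/-- The multiplication operators form a representation of the algebra of the continuous functions
on `[-∞, ∞]`. -/
def mulHom : C(EReal, ℂ) →⋆ₐ[ℂ] (L2R →L[ℂ] L2R) where
  toFun f := multiplication (CS.ofC f)
  map_one' := by
    ext1 u
    refine Lp.ext ?_
    filter_upwards [multiplication_apply_ae (CS.ofC 1) u] with x h
    rw [h]
    simp [CS.ofC]
  map_mul' f g := by
    ext1 u
    refine Lp.ext ?_
    rw [mul_apply_eq_comp]
    filter_upwards [multiplication_apply_ae (CS.ofC (f * g)) u,
      multiplication_apply_ae (CS.ofC f) (multiplication (CS.ofC g) u),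
      multiplication_apply_ae (CS.ofC g) u] with x h1 h2 h3
    rw [h1, h2, h3]
    simp [CS.ofC, mul_assoc]
  map_zero' := by
    ext1 u
    refine Lp.ext ?_
    filter_upwards [multiplication_apply_ae (CS.ofC 0) u, Lp.coeFn_zero ℂ 2 volume] with x h h0
    rw [h, zero_apply, h0]
    simp [CS.ofC]
  map_add' f g := by
    ext1 u
    refine Lp.ext ?_
    rw [add_apply]
    filter_upwards [multiplication_apply_ae (CS.ofC (f + g)) u,
      multiplication_apply_ae (CS.ofC f) u, multiplication_apply_ae (CS.ofC g) u,
      Lp.coeFn_add (multiplication (CS.ofC f) u) (multiplication (CS.ofC g) u)] with x h1 h2 h3 h4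
    rw [h1, h4, Pi.add_apply, h2, h3]
    simp [CS.ofC, add_mul]
  commutes' c := by
    ext1 u
    refine Lp.ext ?_
    rw [Algebra.algebraMap_eq_smul_one, Algebra.algebraMap_eq_smul_one, smul_apply,
      one_apply_eq_self]
    filter_upwards [multiplication_apply_ae (CS.ofC (c • 1)) u, Lp.coeFn_smul c u] with x h1 h2
    rw [h1, h2]
    simp [CS.ofC]
  map_star' f := by
    refine (ContinuousLinearMap.eq_adjoint_iff _ _).2 fun u v => ?_
    rw [L2.inner_def, L2.inner_def]
    refine integral_congr_ae ?_
    filter_upwards [multiplication_apply_ae (CS.ofC (star f)) u,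
      multiplication_apply_ae (CS.ofC f) v] with x h1 h2
    rw [h1, h2]
    simp [CS.ofC, RCLike.inner_apply]
    ring

theorem mulHom_toC (a : CS) : mulHom (CS.toC a) = multiplication a := rfl

theorem mulHom_apply_ae (f : C(EReal, ℂ)) (u : L2R) :
    mulHom f u =ᵐ[volume] fun x => f x * u x :=
  multiplication_apply_ae (CS.ofC f) u

theorem norm_mulHom_le (f : C(EReal, ℂ)) {C : ℝ} (hC : 0 ≤ C) (h : ∀ x : ℝ, ‖f x‖ ≤ C) :
    ‖mulHom f‖ ≤ C :=
  norm_multiplication_le (CS.ofC f) hC h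

/-- Conjugation by the Fourier transform. -/
def fourierConj : (L2R →L[ℂ] L2R) ≃⋆ₐ[ℂ] (L2R →L[ℂ] L2R) :=
  fourier.symm.conjStarAlgEquiv

/-- The Fourier multipliers form a representation of the algebra of the continuous functions
on `[-∞, ∞]`. -/
def fourHom : C(EReal, ℂ) →⋆ₐ[ℂ] (L2R →L[ℂ] L2R) :=
  (fourierConj : (L2R →L[ℂ] L2R) →⋆ₐ[ℂ] (L2R →L[ℂ] L2R)).comp mulHom

theorem fourHom_apply (f : C(EReal, ℂ)) (u : L2R) :
    fourHom f u = fourier.symm (mulHom f (fourier u)) := rfl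

theorem fourHom_toC (a : CS) : fourHom (CS.toC a) = fourierMultiplier a := rfl

theorem fourier_fourHom_apply (f : C(EReal, ℂ)) (u : L2R) :
    fourier (fourHom f u) = mulHom f (fourier u) := by
  rw [fourHom_apply, LinearIsometryEquiv.apply_symm_apply]

theorem norm_fourHom_le (f : C(EReal, ℂ)) {C : ℝ} (hC : 0 ≤ C) (h : ∀ x : ℝ, ‖f x‖ ≤ C) :
    ‖fourHom f‖ ≤ C := by
  refine ContinuousLinearMap.opNorm_le_bound _ hC fun u => ?_
  rw [fourHom_apply, LinearIsometryEquiv.norm_map]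
  refine (ContinuousLinearMap.le_of_opNorm_le _ (norm_mulHom_le f hC h) _).trans ?_
  rw [LinearIsometryEquiv.norm_map]

end Multiplication

section FourierFormula

/-! ### The Fourier integral of integrable functions in `L²(ℝ)` -/

/-- Both sides agree as distributions: against a smooth compactly supported function, the symmetry
of the Fourier integral moves the transform onto the test function, which is also how the tempered
distribution on the left acts. -/
theorem fourierTransform_ae {u : L2R} (hu : Integrable u volume) :
    (Lp.fourierTransformₗᵢ ℝ ℂ u) =ᵐ[volume] 𝓕 (u : ℝ → ℂ) := by
  refine ae_eq_of_integral_contDiff_smul_eq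
    ((Lp.memLp _).locallyIntegrable (by norm_num)) (Continuous.locallyIntegrable ?_) ?_
  · exact VectorFourier.fourierIntegral_continuous Real.continuous_fourierChar
      (innerSL ℝ).continuous₂ hu
  intro g hg hgc
  have hgc' : HasCompactSupport fun x => (g x : ℂ) := hgc.comp_left Complex.ofReal_zero
  have hg' : ContDiff ℝ (⊤ : ℕ∞) fun x => (g x : ℂ) := Complex.ofRealCLM.contDiff.comp hg
  set φ : 𝓢(ℝ, ℂ) := hgc'.toSchwartzMap hg' with hφ
  have h1 := congr_arg (fun T : 𝓢'(ℝ, ℂ) => T φ) (Lp.fourier_toTemperedDistribution_eq u)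
  simp only [TemperedDistribution.fourier_apply, Lp.toTemperedDistribution_apply] at h1
  have h2 := VectorFourier.integral_fourierIntegral_smul_eq_flip (L := innerₗ ℝ)
    (μ := volume) (ν := volume) Real.continuous_fourierChar
    (innerSL ℝ).continuous₂ φ.integrable hu
  have h3 : ∫ x, φ x • (𝓕 u : L2R) x = ∫ x, φ x • (𝓕 (u : ℝ → ℂ)) x := by
    rw [← h1, SchwartzMap.fourier_coe]
    refine Eq.trans h2 ?_
    rw [flip_innerₗ]
    rfl
  exact h3

/-- The integral formula for the Fourier transform of an integrable function in `L²(ℝ)`. -/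
theorem fourier_ae {u : L2R} (hu : Integrable u volume) :
    fourier u =ᵐ[volume] fun x => (1 / Real.sqrt (2 * Real.pi) : ℂ) *
        ∫ t : ℝ, Complex.exp (-Complex.I * x * t) * u t := by
  have hc : (0 : ℝ) < (2 * Real.pi)⁻¹ := by positivity
  have h0 : fourier u = dilateFun hc (Lp.fourierTransformₗᵢ ℝ ℂ u) := rfl
  rw [h0]
  filter_upwards [dilateFun_ae hc (Lp.fourierTransformₗᵢ ℝ ℂ u),
    (quasiMeasurePreserving_mul hc).ae (fourierTransform_ae hu)] with x h1 h2
  rw [h1, h2, Real.fourier_eq', Real.sqrt_inv, Complex.ofReal_inv, one_div]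
  congr 1
  refine integral_congr_ae (Eventually.of_forall fun t => ?_)
  have hpi : (Real.pi : ℂ) ≠ 0 := Complex.ofReal_ne_zero.2 Real.pi_ne_zero
  simp only [smul_eq_mul, RCLike.inner_apply, conj_trivial]
  congr 2
  push_cast
  field_simp

end FourierFormula

end SymbolAlgebra

namespace SymbolAlgebra

section Translation

/-! ### Translations and modulations -/

/-- The translation `u ↦ u (· - t)`. -/
def translation (t : ℝ) : L2R →ₗᵢ[ℂ] L2R :=
  Lp.compMeasurePreservingₗᵢ ℂ (fun x : ℝ => x - t) (measurePreserving_sub_right volume t)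

theorem translation_ae (t : ℝ) (u : L2R) : translation t u =ᵐ[volume] fun x => u (x - t) :=
  Lp.coeFn_compMeasurePreserving u (measurePreserving_sub_right volume t)

theorem norm_exp_I_mul (t x : ℝ) : ‖Complex.exp (Complex.I * t * x)‖ = 1 := by
  rw [Complex.norm_exp]
  simp

theorem memLp_exp (t : ℝ) :
    MemLp (fun x : ℝ => Complex.exp (Complex.I * t * x)) ∞ (volume : Measure ℝ) :=
  memLp_top_of_bound (by fun_prop) 1 (Eventually.of_forall fun x => (norm_exp_I_mul t x).le)

/-- The modulation `u ↦ exp (i t ·) u`. -/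
def modulation (t : ℝ) : L2R →L[ℂ] L2R := mulOp (memLp_exp t).toLp

theorem modulation_ae (t : ℝ) (u : L2R) :
    modulation t u =ᵐ[volume] fun x => Complex.exp (Complex.I * t * x) * u x :=
  mulOp_toLp_ae (memLp_exp t) u

/-- Two bounded operators which agree on the integrable functions are equal. -/
theorem eq_of_integrable {S T : L2R →L[ℂ] L2R} (h : ∀ u : L2R, Integrable u volume → S u = T u) :
    S = T := by
  refine DFunLike.coe_injective (DenseRange.equalizer
    (SchwartzMap.denseRange_toLpCLM (E := ℝ) (F := ℂ) (p := 2) (μ := volume)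
      ENNReal.ofNat_ne_top) S.continuous T.continuous (funext fun u => ?_))
  exact h _ (u.integrable.congr (u.coeFn_toLp 2 volume).symm)

/-- For integrable functions this is a change of variables in the Fourier integral; density extends
it to $L^2$. -/
theorem fourier_translation (t : ℝ) (u : L2R) :
    fourier (translation t u) = modulation (-t) (fourier u) := by
  have h := eq_of_integrable
    (S := (fourier.toContinuousLinearEquiv : L2R →L[ℂ] L2R) ∘L (translation t).toContinuousLinearMap)
    (T := modulation (-t) ∘L (fourier.toContinuousLinearEquiv : L2R →L[ℂ] L2R)) ?_
  · exact congr_arg (fun T : L2R →L[ℂ] L2R => T u) h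
  intro u hu
  change fourier (translation t u) = modulation (-t) (fourier u)
  refine Lp.ext ?_
  have hu' : Integrable (translation t u) volume :=
    (hu.comp_sub_right t).congr (translation_ae t u).symm
  filter_upwards [fourier_ae hu', modulation_ae (-t) (fourier u), fourier_ae hu] with x h1 h2 h3
  rw [h1, h2, h3, mul_left_comm]
  congr 1
  rw [← integral_const_mul]
  rw [← integral_sub_right_eq_self (fun s : ℝ => Complex.exp (Complex.I * ↑(-t) * x) *
    (Complex.exp (-Complex.I * x * s) * u s)) t]
  refine integral_congr_ae ?_
  filter_upwards [translation_ae t u] with s hs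
  rw [hs, ← mul_assoc, ← Complex.exp_add]
  congr 2
  push_cast
  ring

theorem translation_fourier (t : ℝ) (u : L2R) :
    translation t (fourier u) = fourier (modulation t u) := by
  have h := eq_of_integrable
    (S := (translation t).toContinuousLinearMap ∘L (fourier.toContinuousLinearEquiv : L2R →L[ℂ] L2R))
    (T := (fourier.toContinuousLinearEquiv : L2R →L[ℂ] L2R) ∘L modulation t) ?_
  · exact congr_arg (fun T : L2R →L[ℂ] L2R => T u) h
  intro u hu
  change translation t (fourier u) = fourier (modulation t u)
  refine Lp.ext ?_
  have hu' : Integrable (modulation t u) volume :=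
    (hu.bdd_mul (c := 1) (by fun_prop) (Eventually.of_forall fun x =>
      (norm_exp_I_mul t x).le)).congr (modulation_ae t u).symm
  filter_upwards [fourier_ae hu', translation_ae t (fourier u),
    (measurePreserving_sub_right volume t).quasiMeasurePreserving.ae (fourier_ae hu)] with x h1 h2 h3
  rw [h1, h2, h3]
  congr 1
  refine integral_congr_ae ?_
  filter_upwards [modulation_ae t u] with s hs
  rw [hs, ← mul_assoc, ← Complex.exp_add]
  congr 2
  push_cast
  ring

/-- By Plancherel, the matrix coefficients of the translation group are Fourier integrals of an
integrable density. This serves both the Riemann-Lebesgue argument and the commutator estimate. -/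
theorem inner_translation (t : ℝ) (u v : L2R) :
    ⟪v, translation t u⟫ =
      ∫ x : ℝ, Complex.exp (-Complex.I * t * x) * ⟪fourier v x, fourier u x⟫ := by
  rw [← LinearIsometryEquiv.inner_map_map fourier, fourier_translation, L2.inner_def]
  refine integral_congr_ae ?_
  filter_upwards [modulation_ae (-t) (fourier u)] with x h
  rw [h, RCLike.inner_apply, RCLike.inner_apply, mul_assoc]
  push_cast
  ring_nf

/-- The translates of a function converge weakly to zero at infinity. -/
theorem tendsto_inner_translation (u v : L2R) :
    Tendsto (fun t : ℝ => ⟪v, translation t u⟫) (cocompact ℝ) (𝓝 0) := by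
  -- Riemann-Lebesgue lemma. Its characters are $e^{-2\pi itx}$, whence the rescaling of $t$ by
  -- $(2\pi)^{-1}$ below.
  have h := Real.tendsto_integral_exp_smul_cocompact
    fun x : ℝ => (⟪fourier v x, fourier u x⟫ : ℂ)
  have h2 : Tendsto (fun t : ℝ => t * (2 * Real.pi)⁻¹) (cocompact ℝ) (cocompact ℝ) :=
    (Homeomorph.mulRight₀ (2 * Real.pi)⁻¹ (by positivity)).isClosedEmbedding.tendsto_cocompact
  refine (h.comp h2).congr fun t => ?_
  rw [inner_translation]
  refine integral_congr_ae (Eventually.of_forall fun x => ?_)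
  simp only [Circle.smul_def, Real.fourierChar_apply, smul_eq_mul]
  congr 2
  have hpi : (Real.pi : ℂ) ≠ 0 := Complex.ofReal_ne_zero.2 Real.pi_ne_zero
  push_cast
  field_simp

/-- The Fourier transform conjugates modulations to translations, whose strong continuity on $L^2$
is used. -/
theorem continuous_modulation (u : L2R) : Continuous fun t => modulation t u := by
  have h : (fun t => modulation t u) = fun t => fourier.symm (translation t (fourier u)) := by
    funext t
    rw [translation_fourier, LinearIsometryEquiv.symm_apply_apply]
  rw [h]
  refine fourier.symm.continuous.comp ?_
  exact Continuous.compMeasurePreservingLp (f := fun _ : ℝ => fourier u)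
    (g := fun t : ℝ => ⟨fun x => x - t, by fun_prop⟩) continuous_const
    (ContinuousMap.curry ⟨fun p : ℝ × ℝ => p.2 - p.1, by fun_prop⟩).continuous
    (fun t => measurePreserving_sub_right volume t) (by norm_num)

theorem norm_modulation (t : ℝ) (u : L2R) : ‖modulation t u‖ = ‖u‖ := by
  rw [← LinearIsometryEquiv.norm_map fourier, ← translation_fourier, LinearIsometry.norm_map,
    LinearIsometryEquiv.norm_map]

theorem modulation_zero (u : L2R) : modulation 0 u = u := by
  refine Lp.ext ?_
  filter_upwards [modulation_ae 0 u] with x h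
  rw [h]
  simp

end Translation

section Representation

/-! ### The operators `a(M) b(D) c(M)` as integrals of operators of rank one -/

open InnerProductSpace

theorem inner_fourHom (b : C(EReal, ℂ)) (u v : L2R) :
    ⟪v, fourHom b u⟫ = ∫ x : ℝ, b x * ⟪fourier v x, fourier u x⟫ := by
  rw [← LinearIsometryEquiv.inner_map_map fourier, fourier_fourHom_apply, L2.inner_def]
  refine integral_congr_ae ?_
  filter_upwards [mulHom_apply_ae b (fourier u)] with x h
  rw [h, RCLike.inner_apply, RCLike.inner_apply, mul_assoc]

/-- The Fourier transform of `f u`, for `f` square-integrable. -/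
theorem fourier_mulHom_ae (f : C(EReal, ℂ)) (hf : MemLp (fun x : ℝ => star (f x)) 2 volume)
    (u : L2R) : fourier (mulHom f u) =ᵐ[volume] fun ξ =>
      (1 / Real.sqrt (2 * Real.pi) : ℂ) * ⟪modulation ξ hf.toLp, u⟫ := by
  have hf' : MemLp (fun x : ℝ => f x) 2 volume := by
    have h := hf.star
    rwa [show star (fun x : ℝ => star (f x)) = fun x : ℝ => f x from funext fun x => star_star _] at h
  have hi : Integrable (mulHom f u) volume :=
    (hf'.integrable_mul (Lp.memLp u)).congr (mulHom_apply_ae f u).symm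
  filter_upwards [fourier_ae hi] with ξ h
  rw [h, L2.inner_def]
  congr 1
  refine integral_congr_ae ?_
  filter_upwards [mulHom_apply_ae f u, modulation_ae ξ hf.toLp, hf.coeFn_toLp] with x h1 h2 h3
  rw [h1, h2, h3, RCLike.inner_apply, map_mul, ← Complex.exp_conj]
  simp
  ring

/-- Strong continuity of the modulations becomes norm continuity here. This makes the integrals of
rank one operators Bochner integrals in the operator norm. -/
theorem continuous_rankOne {X : Type*} [TopologicalSpace X] {v w : X → L2R} (hv : Continuous v)
    (hw : Continuous w) : Continuous fun x => rankOne ℂ (v x) (w x) := by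
  refine continuous_iff_continuousAt.2 fun x => tendsto_iff_norm_sub_tendsto_zero.2 ?_
  have h : Tendsto (fun y => ‖v y - v x‖ * ‖w y‖ + ‖v x‖ * ‖w y - w x‖) (𝓝 x) (𝓝 0) := by
    have : Continuous fun y => ‖v y - v x‖ * ‖w y‖ + ‖v x‖ * ‖w y - w x‖ := by fun_prop
    simpa using this.tendsto x
  refine squeeze_zero (fun _ => norm_nonneg _) (fun y => ?_) h
  have h2 : rankOne ℂ (v y) (w y) - rankOne ℂ (v x) (w x)
      = rankOne ℂ (v y - v x) (w y) + rankOne ℂ (v x) (w y - w x) := by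
    simp
  rw [h2, ← norm_rankOne (𝕜 := ℂ), ← norm_rankOne (𝕜 := ℂ)]
  exact norm_add_le _ _

theorem integrable_smul_rankOne {b : ℝ → ℂ} (hb : Integrable b volume) (v w : L2R) :
    Integrable (fun ξ : ℝ => b ξ • rankOne ℂ (modulation ξ v) (modulation ξ w)) volume := by
  have hc : Continuous fun ξ : ℝ => rankOne ℂ (modulation ξ v) (modulation ξ w) := by
    have h1 := continuous_modulation v
    have h2 := continuous_modulation w
    exact (continuous_rankOne h1 h2)
  refine hb.smul_bdd (‖v‖ * ‖w‖) hc.aestronglyMeasurable (Eventually.of_forall fun ξ => ?_)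
  rw [norm_rankOne, norm_modulation, norm_modulation]

/-- Write $e_\xi(x)=e^{i\xi x}$. Since $F(gu)(\xi)=(2\pi)^{-1/2}\langle e_\xi\bar g,u\rangle$,
Plancherel writes $\langle v,f(M)b(D)g(M)u\rangle$ as an integral over $\xi$ of products of two such
coefficients; the two normalizing factors combine to $1/2\pi$. -/
theorem mulHom_mul_fourHom_mul_mulHom (f g b : C(EReal, ℂ))
    (hf : MemLp (fun x : ℝ => f x) 2 volume) (hg : MemLp (fun x : ℝ => star (g x)) 2 volume)
    (hb : Integrable (fun x : ℝ => b x) volume) :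
    mulHom f * fourHom b * mulHom g = (1 / (2 * Real.pi) : ℂ) •
      ∫ ξ : ℝ, b ξ • rankOne ℂ (modulation ξ hf.toLp) (modulation ξ hg.toLp) := by
  ext1 u
  refine ext_inner_left ℂ fun v => ?_
  have hi := integrable_smul_rankOne hb hf.toLp hg.toLp
  rw [smul_apply, inner_smul_right, ContinuousLinearMap.integral_apply hi,
    ← integral_inner (hi.apply_continuousLinearMap u)]
  have h1 : ⟪v, (mulHom f * fourHom b * mulHom g) u⟫
      = ⟪mulHom (star f) v, fourHom b (mulHom g u)⟫ := by
    rw [map_star, ContinuousLinearMap.star_eq_adjoint, ContinuousLinearMap.adjoint_inner_left]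
    rfl
  have hf' : MemLp (fun x : ℝ => star ((star f : C(EReal, ℂ)) x)) 2 volume := by simpa using! hf
  have hff : hf'.toLp = hf.toLp := by
    congr 1
    funext x
    simp
  rw [h1, inner_fourHom, ← integral_const_mul]
  refine integral_congr_ae ?_
  filter_upwards [fourier_mulHom_ae (star f) hf' v, fourier_mulHom_ae g hg u] with ξ h2 h3
  have hsq : ((Real.sqrt (2 * Real.pi) : ℝ) : ℂ) * (Real.sqrt (2 * Real.pi) : ℝ)
      = 2 * (Real.pi : ℂ) := by
    rw [← Complex.ofReal_mul, Real.mul_self_sqrt (by positivity)]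
    push_cast
    ring
  rw [h2, h3, hff, smul_apply, rankOne_apply, inner_smul_right, inner_smul_right,
    RCLike.inner_apply, map_mul, inner_conj_symm, ← hsq]
  simp only [map_div₀, map_one, Complex.conj_ofReal]
  ring

end Representation

end SymbolAlgebra

namespace SymbolAlgebra

section Approximation

/-! ### Functions with compact support -/

/-- The functions vanishing at `±∞` are limits of functions with compact support in `ℝ`. -/
theorem mem_closure_hasCompactSupport {f : C(EReal, ℂ)} (h1 : f ⊤ = 0) (h2 : f ⊥ = 0) :
    f ∈ closure {g : C(EReal, ℂ) | HasCompactSupport fun x : ℝ => g x} := by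
  refine Metric.mem_closure_iff.2 fun ε hε => ?_
  set δ := ε / 2 with hδ
  have hδ0 : 0 < δ := half_pos hε
  have hm : ∀ x, 0 < max δ ‖f x‖ := fun x => lt_max_of_lt_left hδ0
  -- `p` is `f` truncated radially to modulus at most $\delta$. So `f - p` vanishes wherever
  -- $|f|\le\delta$, in particular near $\pm\infty$, and differs from `f` by at most $\delta$.
  let p : C(EReal, ℂ) := ⟨fun x => ((δ / max δ ‖f x‖ : ℝ) : ℂ) * f x, by
    refine Continuous.mul (Complex.continuous_ofReal.comp ?_) f.continuous
    exact continuous_const.div (by fun_prop) fun x => (hm x).ne'⟩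
  have hp : ∀ x, p x = ((δ / max δ ‖f x‖ : ℝ) : ℂ) * f x := fun x => rfl
  refine ⟨f - p, ?_, ?_⟩
  · rw [Set.mem_ofPred_eq, hasCompactSupport_iff_eventuallyEq, Filter.coclosedCompact_eq_cocompact,
      cocompact_eq_atBot_atTop]
    have key : ∀ᶠ y in 𝓝 (0 : ℂ), ‖y‖ ≤ δ := by
      filter_upwards [Metric.closedBall_mem_nhds (0 : ℂ) hδ0] with y hy
      simpa using hy
    have h3 : ∀ x, ‖f x‖ ≤ δ → (f - p) x = 0 := by
      intro x hx
      rw [ContinuousMap.sub_apply, hp, max_eq_left hx, div_self hδ0.ne']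
      simp
    refine Filter.eventually_sup.2 ⟨?_, ?_⟩
    · have := (f.continuous.tendsto ⊥).comp EReal.tendsto_coe_atBot
      rw [h2] at this
      exact (this.eventually key).mono fun x hx => h3 x hx
    · have := (f.continuous.tendsto ⊤).comp EReal.tendsto_coe_atTop
      rw [h1] at this
      exact (this.eventually key).mono fun x hx => h3 x hx
  · rw [dist_eq_norm, sub_sub_cancel]
    refine lt_of_le_of_lt ((ContinuousMap.norm_le _ hδ0.le).2 fun x => ?_) (half_lt_self hε)
    rw [hp, norm_mul, Complex.norm_real, Real.norm_of_nonneg (by positivity), div_mul_eq_mul_div,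
      div_le_iff₀ (hm x)]
    gcongr
    exact le_max_right _ _

/-- A continuous function with compact support as a function on `[-∞, ∞]`. -/
def ofCompactSupport (f : ℝ → ℂ) (hc : Continuous f) (hf : HasCompactSupport f) : C(EReal, ℂ) :=
  CS.toC ⟨f, hc, ⟨0, hf.is_zero_at_infty.mono_left (by
    rw [cocompact_eq_atBot_atTop]; exact le_sup_right)⟩,
    ⟨0, hf.is_zero_at_infty.mono_left (by
      rw [cocompact_eq_atBot_atTop]; exact le_sup_left)⟩⟩

theorem ofCompactSupport_coe (f : ℝ → ℂ) (hc : Continuous f) (hf : HasCompactSupport f) (x : ℝ) :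
    ofCompactSupport f hc hf x = f x := rfl

theorem continuous_coe_real (f : C(EReal, ℂ)) : Continuous fun x : ℝ => f x :=
  f.continuous.comp continuous_coe_real_ereal

end Approximation

section CompactProducts

/-! ### Compactness of the products `a(M) b(D)` -/

open InnerProductSpace

variable {H : Type*} [NormedAddCommGroup H] [InnerProductSpace ℂ H] [CompleteSpace H]

/-- The compact operators form a closed subspace; the projection modulo this subspace commutes with
the integral and kills the integrand. Integrability need not be assumed, since otherwise the
integral is $0$ by convention. -/
theorem isCompactOperator_integral {f : ℝ → H →L[ℂ] H} (hf : ∀ x, IsCompactOperator (f x)) :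
    IsCompactOperator (∫ x, f x : H →L[ℂ] H) := by
  by_cases hi : Integrable f volume
  swap
  · rw [integral_undef hi]
    exact isCompactOperator_zero
  let S : Submodule ℂ (H →L[ℂ] H) := compactOperator (RingHom.id ℂ) H H
  have hS : IsClosed (S : Set (H →L[ℂ] H)) := isClosed_setOfPred_isCompactOperator
  have h1 : S.mkQL (∫ x, f x) = ∫ x, S.mkQL (f x) :=
    (ContinuousLinearMap.integral_comp_comm S.mkQL hi).symm
  have h2 : ∀ x, S.mkQL (f x) = 0 := fun x => by
    rw [Submodule.mkQL_apply, Submodule.mkQ_apply]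
    exact (Submodule.Quotient.mk_eq_zero S).2 (hf x)
  simp only [h2, integral_zero] at h1
  rw [Submodule.mkQL_apply, Submodule.mkQ_apply] at h1
  exact (Submodule.Quotient.mk_eq_zero S).1 h1

theorem continuous_mulHom : Continuous mulHom :=
  AddMonoidHomClass.continuous_of_bound mulHom 1 fun f => by
    rw [one_mul]
    exact norm_mulHom_le f (norm_nonneg f) fun x => f.norm_coe_le_norm x

theorem continuous_fourHom : Continuous fourHom :=
  AddMonoidHomClass.continuous_of_bound fourHom 1 fun f => by
    rw [one_mul]
    exact norm_fourHom_le f (norm_nonneg f) fun x => f.norm_coe_le_norm x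

/-- For $T=b(D)g(M)$ the operator $T^*T=\bar g(M)\,|b|^2(D)\,g(M)$ has the sandwich form that is an
integral of rank one operators. -/
theorem isCompactOperator_fourHom_mul_mulHom_of_hasCompactSupport {b g : C(EReal, ℂ)}
    (hb : HasCompactSupport fun x : ℝ => b x) (hg : HasCompactSupport fun x : ℝ => g x) :
    IsCompactOperator (fourHom b * mulHom g : L2R →L[ℂ] L2R) := by
  refine isCompactOperator_of_star_mul_self ?_
  have hg' : MemLp (fun x : ℝ => star (g x)) 2 volume :=
    ((continuous_coe_real g).star).memLp_of_hasCompactSupport (hg.comp_left (star_zero ℂ))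
  have hb' : Integrable (fun x : ℝ => (star b * b : C(EReal, ℂ)) x) volume :=
    (continuous_coe_real (star b * b)).integrable_of_hasCompactSupport hb.mul_left
  have h : star (fourHom b * mulHom g : L2R →L[ℂ] L2R) * (fourHom b * mulHom g)
      = mulHom (star g) * fourHom (star b * b) * mulHom g := by
    rw [star_mul, map_mul, map_star, map_star]
    noncomm_ring
  have hg2 : MemLp (fun x : ℝ => (star g : C(EReal, ℂ)) x) 2 volume := hg'
  rw [h, mulHom_mul_fourHom_mul_mulHom (star g) g (star b * b) hg2 hg' hb']
  have hc := isCompactOperator_integral fun ξ : ℝ => (compactOperator (RingHom.id ℂ) L2R L2R).smul_mem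
    ((star b * b : C(EReal, ℂ)) ξ)
    (isCompactOperator_rankOne (modulation ξ hg2.toLp) (modulation ξ hg'.toLp))
  exact (compactOperator (RingHom.id ℂ) L2R L2R).smul_mem (1 / (2 * Real.pi) : ℂ) hc

theorem isCompactOperator_fourHom_mul_mulHom {b g : C(EReal, ℂ)} (hb1 : b ⊤ = 0) (hb2 : b ⊥ = 0)
    (hg1 : g ⊤ = 0) (hg2 : g ⊥ = 0) :
    IsCompactOperator (fourHom b * mulHom g : L2R →L[ℂ] L2R) := by
  have hcl : IsClosed {T : L2R →L[ℂ] L2R | IsCompactOperator T} :=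
    isClosed_setOfPred_isCompactOperator
  have hm := continuous_mulHom
  have hf := continuous_fourHom
  have h1 : ∀ b' : C(EReal, ℂ), (HasCompactSupport fun x : ℝ => b' x) →
      IsCompactOperator (fourHom b' * mulHom g : L2R →L[ℂ] L2R) := fun b' hb' =>
    closure_minimal (fun g' hg' => isCompactOperator_fourHom_mul_mulHom_of_hasCompactSupport hb' hg')
      (hcl.preimage (continuous_const.mul hm)) (mem_closure_hasCompactSupport hg1 hg2)
  exact closure_minimal h1 (hcl.preimage (hf.mul continuous_const))
    (mem_closure_hasCompactSupport hb1 hb2)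

theorem isCompactOperator_mulHom_mul_fourHom {a b : C(EReal, ℂ)} (ha1 : a ⊤ = 0) (ha2 : a ⊥ = 0)
    (hb1 : b ⊤ = 0) (hb2 : b ⊥ = 0) :
    IsCompactOperator (mulHom a * fourHom b : L2R →L[ℂ] L2R) := by
  have h := isCompactOperator_star (isCompactOperator_fourHom_mul_mulHom (b := star b) (g := star a)
    (by simp [hb1]) (by simp [hb2]) (by simp [ha1]) (by simp [ha2]))
  rwa [star_mul, map_star, map_star, star_star, star_star] at h

/-- The operators of rank one as limits of operators `a(M) b(D) c(M)`. -/
theorem rankOne_mem_of_mulHom_mul_fourHom_mul_mulHom_mem {S : Submodule ℂ (L2R →L[ℂ] L2R)}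
    (hS : IsClosed (S : Set (L2R →L[ℂ] L2R))) {f g : C(EReal, ℂ)}
    (hf : MemLp (fun x : ℝ => f x) 2 volume) (hg : MemLp (fun x : ℝ => star (g x)) 2 volume)
    (h : ∀ b : C(EReal, ℂ), mulHom f * fourHom b * mulHom g ∈ S) :
    rankOne ℂ hf.toLp hg.toLp ∈ S := by
  refine hS.closure_subset (Metric.mem_closure_iff.2 fun ε hε => ?_)
  set R : ℝ → L2R →L[ℂ] L2R := fun ξ => rankOne ℂ (modulation ξ hf.toLp) (modulation ξ hg.toLp)
    with hR
  have hRc : Continuous R := continuous_rankOne (continuous_modulation _) (continuous_modulation _)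
  have hR0 : R 0 = rankOne ℂ hf.toLp hg.toLp := by simp only [hR, modulation_zero]
  obtain ⟨δ, hδ, hδR⟩ := Metric.continuousAt_iff.1 hRc.continuousAt (ε / 2) (half_pos hε)
  -- The normalized bump is an approximate identity at $0$: the integral averages the
  -- norm-continuous family `R` over $|\xi|<\delta$, so it is close to `R 0`.
  let φ : ContDiffBump (0 : ℝ) := ⟨δ / 2, δ, half_pos hδ, half_lt_self hδ⟩
  have hφc : Continuous fun x : ℝ => ((φ.normed volume x : ℝ) : ℂ) :=
    Complex.continuous_ofReal.comp φ.continuous_normed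
  have hφs : HasCompactSupport fun x : ℝ => ((φ.normed volume x : ℝ) : ℂ) :=
    φ.hasCompactSupport_normed.comp_left Complex.ofReal_zero
  have hφi : Integrable (fun x : ℝ => ((φ.normed volume x : ℝ) : ℂ)) volume :=
    hφc.integrable_of_hasCompactSupport hφs
  have hφ1 : ∫ x : ℝ, ((φ.normed volume x : ℝ) : ℂ) = 1 := by
    rw [integral_complex_ofReal, φ.integral_normed, Complex.ofReal_one]
  have key := mulHom_mul_fourHom_mul_mulHom f g (ofCompactSupport _ hφc hφs) hf hg hφi
  have hmem := S.smul_mem (2 * Real.pi : ℂ) (h (ofCompactSupport _ hφc hφs))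
  have hpi : (2 * Real.pi : ℂ) ≠ 0 := by simp [Real.pi_ne_zero]
  rw [key, smul_smul, mul_one_div_cancel hpi, one_smul] at hmem
  refine ⟨_, hmem, ?_⟩
  have hi1 := integrable_smul_rankOne hφi hf.toLp hg.toLp
  have h0 : R 0 = ∫ x : ℝ, ((φ.normed volume x : ℝ) : ℂ) • R 0 := by
    rw [integral_smul_const (𝕜 := ℂ), hφ1, one_smul]
  rw [← hR0, dist_eq_norm, h0]
  simp only [ofCompactSupport_coe]
  rw [← integral_sub (hφi.smul_const _) hi1]
  refine lt_of_le_of_lt (norm_integral_le_of_norm_le (φ.integrable_normed.const_mul (ε / 2))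
    (Eventually.of_forall fun x => ?_)) ?_
  · rw [← smul_sub, norm_smul, Complex.norm_real, Real.norm_of_nonneg (φ.nonneg_normed x), mul_comm]
    by_cases hx : dist x 0 < δ
    · gcongr
      · exact φ.nonneg_normed x
      · have := (hδR hx).le
        rwa [dist_comm, dist_eq_norm] at this
    · have : φ.normed volume x = 0 := by
        have hs := φ.support_normed_eq (μ := volume)
        by_contra hne
        have : x ∈ Function.support (φ.normed volume) := hne
        rw [hs] at this
        exact hx this
      rw [this]
      simp
  · rw [integral_const_mul, φ.integral_normed, mul_one]
    exact half_lt_self hε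

end CompactProducts

end SymbolAlgebra

namespace SymbolAlgebra

section ArctanIntegral

/-! ### Integrals against `arctan (r ξ)` -/

open Complex (I)

variable {φ : ℝ → ℂ} {L : ℝ}

/-- The resolvent is a Laplace transform: $(1-ir\xi)^{-1}=\int_0^\infty e^{-t}e^{irt\xi}\,dt$. After
Fubini the hypothesis bounds the inner integral by $L|r|t$, and $\int_0^\infty
te^{-t}\,dt=\Gamma(2)=1$. -/
theorem norm_integral_inv_one_sub_mul_le (hφ : Integrable φ volume)
    (h : ∀ t : ℝ, ‖∫ ξ : ℝ, Complex.exp (-I * t * ξ) * φ ξ‖ ≤ L * |t|) (r : ℝ) :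
    ‖∫ ξ : ℝ, (1 - I * r * ξ)⁻¹ * φ ξ‖ ≤ L * |r| := by
  have he : Integrable (fun t : ℝ => ((Real.exp (-t) : ℝ) : ℂ)) (volume.restrict (Set.Ioi 0)) :=
    (integrableOn_exp_neg_Ioi 0).ofReal
  have h1 : ∀ ξ : ℝ, (1 - I * r * ξ)⁻¹ * φ ξ = ∫ t : ℝ in Set.Ioi 0,
      Complex.exp ((I * r * ξ - 1) * t) * φ ξ := by
    intro ξ
    rw [integral_mul_const, integral_exp_mul_complex_Ioi (by simp)]
    simp only [Complex.ofReal_zero, mul_zero, Complex.exp_zero]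
    rw [neg_div, one_div, ← inv_neg, neg_sub]
  have hint : Integrable (Function.uncurry fun ξ t : ℝ => Complex.exp ((I * r * ξ - 1) * t) * φ ξ)
      (volume.prod (volume.restrict (Set.Ioi 0))) := by
    have h2 := hφ.mul_prod he
    refine (h2.bdd_mul (c := 1) (f := fun z : ℝ × ℝ => Complex.exp (I * (r * z.1 * z.2 : ℝ) * (1 : ℝ)))
      (by fun_prop) (Eventually.of_forall fun z => (norm_exp_I_mul _ _).le)).congr
      (Eventually.of_forall fun z => ?_)
    simp only [Function.uncurry]
    rw [mul_left_comm, mul_comm (φ z.1)]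
    push_cast
    rw [← mul_assoc, ← Complex.exp_add]
    congr 2
    ring
  simp_rw [h1]
  rw [integral_integral_swap hint]
  have hG : Real.Gamma 2 = ∫ x in Set.Ioi 0, Real.exp (-x) * x ^ ((2 : ℝ) - 1) :=
    Real.Gamma_eq_integral two_pos
  have hGi : IntegrableOn (fun x : ℝ => Real.exp (-x) * x ^ ((2 : ℝ) - 1)) (Set.Ioi 0) :=
    Real.GammaIntegral_convergent two_pos
  rw [Real.Gamma_two] at hG
  refine (norm_integral_le_of_norm_le (hGi.mul_const (L * |r|))
    ((ae_restrict_iff' measurableSet_Ioi).2 (Eventually.of_forall fun t ht => ?_))).trans ?_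
  · have ht0 : (0 : ℝ) < t := ht
    have h3 : ∫ ξ : ℝ, Complex.exp ((I * r * ξ - 1) * t) * φ ξ
        = ((Real.exp (-t) : ℝ) : ℂ) * ∫ ξ : ℝ, Complex.exp (-I * ((-(r * t) : ℝ) : ℂ) * ξ) * φ ξ := by
      rw [← integral_const_mul]
      refine integral_congr_ae (Eventually.of_forall fun ξ => ?_)
      simp only
      rw [← mul_assoc, Complex.ofReal_exp, ← Complex.exp_add]
      congr 2
      push_cast
      ring
    rw [h3, norm_mul, Complex.norm_real, Real.norm_of_nonneg (Real.exp_pos _).le, mul_assoc]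
    refine mul_le_mul_of_nonneg_left ((h _).trans (le_of_eq ?_)) (Real.exp_pos _).le
    rw [abs_neg, abs_mul, abs_of_pos ht0, show (2 : ℝ) - 1 = 1 by norm_num, Real.rpow_one]
    ring
  · rw [integral_mul_const, ← hG, one_mul]

/-- Partial fractions: $\frac{s}{1+s^2}=\frac1{2i}\left(\frac1{1-is}-\frac1{1+is}\right)$ with
$s=r\xi$, each half contributing $L|r|/2$. -/
theorem norm_integral_div_one_add_sq_mul_le (hφ : Integrable φ volume)
    (h : ∀ t : ℝ, ‖∫ ξ : ℝ, Complex.exp (-I * t * ξ) * φ ξ‖ ≤ L * |t|) (r : ℝ) :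
    ‖∫ ξ : ℝ, ((r * ξ / (1 + (r * ξ) ^ 2) : ℝ) : ℂ) * φ ξ‖ ≤ L * |r| := by
  have hne : ∀ s ξ : ℝ, (1 - I * s * ξ : ℂ) ≠ 0 := fun s ξ h0 => by
    have := congr_arg Complex.re h0
    simp at this
  have hi : ∀ s : ℝ, Integrable (fun ξ : ℝ => (1 - I * s * ξ)⁻¹ * φ ξ) volume := by
    intro s
    refine hφ.bdd_mul (c := 1) (Continuous.aestronglyMeasurable
      (Continuous.inv₀ (by fun_prop) (hne s))) (Eventually.of_forall fun ξ => ?_)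
    rw [norm_inv]
    refine inv_le_one_of_one_le₀ ?_
    have := Complex.abs_re_le_norm (1 - I * s * ξ)
    simpa using this
  have h1 : ∫ ξ : ℝ, ((r * ξ / (1 + (r * ξ) ^ 2) : ℝ) : ℂ) * φ ξ = (1 / (2 * I)) *
      (∫ ξ : ℝ, (1 - I * r * ξ)⁻¹ * φ ξ) - (1 / (2 * I)) *
      (∫ ξ : ℝ, (1 - I * ((-r : ℝ) : ℂ) * ξ)⁻¹ * φ ξ) := by
    rw [← integral_const_mul, ← integral_const_mul,
      ← integral_sub ((hi r).const_mul _) ((hi (-r)).const_mul _)]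
    refine integral_congr_ae (Eventually.of_forall fun ξ => ?_)
    simp only
    rw [← mul_assoc, ← mul_assoc, ← sub_mul]
    congr 1
    have e1 := hne r ξ
    have e2 := hne (-r) ξ
    have e3 : (1 + ((r : ℂ) * ξ) ^ 2) ≠ 0 := by
      have h3 : (1 + (r * ξ) ^ 2 : ℝ) ≠ 0 := by positivity
      exact_mod_cast h3
    have e4 : (1 + ((r : ℂ) * ξ) ^ 2) = (1 - I * r * ξ) * (1 - I * ((-r : ℝ) : ℂ) * ξ) := by
      push_cast
      linear_combination ((r : ℂ) ^ 2 * ξ ^ 2) * Complex.I_sq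
    have e5 : (1 - I * ((-r : ℝ) : ℂ) * ξ) - (1 - I * r * ξ) = 2 * I * (r * ξ) := by
      push_cast
      ring
    push_cast at e2 e4 e5 ⊢
    rw [e4, div_eq_iff (mul_ne_zero e1 e2)]
    generalize (1 - I * r * ξ : ℂ) = X at e1 e5 ⊢
    generalize (1 - I * -r * ξ : ℂ) = Y at e2 e5 ⊢
    have e6 : (1 / (2 * I) * X⁻¹ - 1 / (2 * I) * Y⁻¹) * (X * Y) = 1 / (2 * I) * (Y - X) := by
      field_simp
    rw [e6, e5, ← mul_assoc, one_div, inv_mul_cancel₀ (mul_ne_zero two_ne_zero Complex.I_ne_zero),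
      one_mul]
  have hn : ‖(1 / (2 * I) : ℂ)‖ = 1 / 2 := by simp
  rw [h1]
  refine (norm_sub_le _ _).trans ?_
  rw [norm_mul, norm_mul, hn]
  have b1 := norm_integral_inv_one_sub_mul_le hφ h r
  have b2 := norm_integral_inv_one_sub_mul_le hφ h (-r)
  rw [abs_neg] at b2
  linarith

/-- The $r$-derivative of $\arctan(r\xi)$ is $r^{-1}\cdot\frac{r\xi}{1+(r\xi)^2}$, so the preceding
bound shows that the integral has derivative at most $L$ in norm for $r>0$; it vanishes at $r=0$. -/
theorem norm_integral_arctan_mul_le (hφ : Integrable φ volume)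
    (h : ∀ t : ℝ, ‖∫ ξ : ℝ, Complex.exp (-I * t * ξ) * φ ξ‖ ≤ L * |t|) {r : ℝ} (hr : 0 < r) :
    ‖∫ ξ : ℝ, ((Real.arctan (r * ξ) : ℝ) : ℂ) * φ ξ‖ ≤ L * r := by
  set G : ℝ → ℂ := fun r => ∫ ξ : ℝ, ((Real.arctan (r * ξ) : ℝ) : ℂ) * φ ξ with hG
  have hm : ∀ r : ℝ, AEStronglyMeasurable
      (fun ξ : ℝ => ((Real.arctan (r * ξ) : ℝ) : ℂ) * φ ξ) volume := fun r =>
    AEStronglyMeasurable.mul (Continuous.aestronglyMeasurable (by fun_prop))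
      hφ.aestronglyMeasurable
  have hb : ∀ r ξ : ℝ, ‖((Real.arctan (r * ξ) : ℝ) : ℂ) * φ ξ‖ ≤ Real.pi / 2 * ‖φ ξ‖ := by
    intro r ξ
    rw [norm_mul, Complex.norm_real]
    refine mul_le_mul_of_nonneg_right ?_ (norm_nonneg _)
    exact abs_le.2 ⟨(Real.neg_pi_div_two_lt_arctan _).le, (Real.arctan_lt_pi_div_two _).le⟩
  have hcont : Continuous G := continuous_of_dominated hm
    (fun r => Eventually.of_forall (hb r)) (hφ.norm.const_mul _)
    (Eventually.of_forall fun ξ => by fun_prop)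
  have hderiv : ∀ x : ℝ, 0 < x → ∃ G' : ℂ, HasDerivAt G G' x ∧ ‖G'‖ ≤ L := by
    intro x hx
    refine ⟨∫ ξ : ℝ, ((ξ / (1 + (x * ξ) ^ 2) : ℝ) : ℂ) * φ ξ, ?_, ?_⟩
    · refine (hasDerivAt_integral_of_dominated_loc_of_deriv_le (s := Set.Ioi (x / 2))
        (bound := fun ξ => x⁻¹ * ‖φ ξ‖)
        (F' := fun (x ξ : ℝ) => ((ξ / (1 + (x * ξ) ^ 2) : ℝ) : ℂ) * φ ξ)
        (Ioi_mem_nhds (half_lt_self hx)) (Eventually.of_forall hm)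
        ((hφ.norm.const_mul _).mono' (hm x) (Eventually.of_forall (hb x))) ?_ ?_
        (hφ.norm.const_mul _) ?_).2
      · refine AEStronglyMeasurable.mul (Continuous.aestronglyMeasurable
          (Complex.continuous_ofReal.comp (Continuous.div (by fun_prop) (by fun_prop) ?_)))
          hφ.aestronglyMeasurable
        intro ξ
        positivity
      · refine Eventually.of_forall fun ξ y hy => ?_
        have hy' : x / 2 < y := hy
        have hy0 : 0 < y := lt_trans (half_pos hx) hy'
        rw [norm_mul, Complex.norm_real, Real.norm_eq_abs, abs_div,
          abs_of_pos (show 0 < 1 + (y * ξ) ^ 2 by positivity)]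
        refine mul_le_mul_of_nonneg_right ?_ (norm_nonneg _)
        rw [div_le_iff₀ (by positivity), ← div_eq_inv_mul, le_div_iff₀ hx]
        -- For $s=y|\xi|$ one has $1+s^2\ge2s\ge x|\xi|$, because $y>x/2$; this gives the dominating
        -- bound $x^{-1}\|\varphi\|$.
        have e1 : |ξ| * x ≤ 2 * (y * |ξ|) := by nlinarith [abs_nonneg ξ]
        have e2 : (y * ξ) ^ 2 = (y * |ξ|) ^ 2 := by rw [mul_pow, mul_pow, sq_abs]
        rw [e2]
        nlinarith [sq_nonneg (y * |ξ| - 1)]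
      · refine Eventually.of_forall fun ξ y _ => ?_
        have h1 : HasDerivAt (fun y : ℝ => Real.arctan (y * ξ)) (ξ / (1 + (y * ξ) ^ 2)) y := by
          have := ((hasDerivAt_id y).mul_const ξ).arctan
          simpa [div_eq_inv_mul] using this
        exact h1.ofReal_comp.mul_const (φ ξ)
    · have h2 : ∫ ξ : ℝ, ((ξ / (1 + (x * ξ) ^ 2) : ℝ) : ℂ) * φ ξ
          = (x : ℂ)⁻¹ * ∫ ξ : ℝ, ((x * ξ / (1 + (x * ξ) ^ 2) : ℝ) : ℂ) * φ ξ := by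
        rw [← integral_const_mul]
        refine integral_congr_ae (Eventually.of_forall fun ξ => ?_)
        have hx' : (x : ℂ) ≠ 0 := Complex.ofReal_ne_zero.2 hx.ne'
        simp only
        push_cast
        field_simp
      rw [h2, norm_mul, norm_inv, Complex.norm_real, Real.norm_of_nonneg hx.le,
        inv_mul_le_iff₀ hx, mul_comm]
      simpa [abs_of_pos hx] using norm_integral_div_one_add_sq_mul_le hφ h x
  choose! G' hG' hGL using hderiv
  -- Differentiation under the integral is justified only for positive parameters, since
  -- $\xi\varphi$ need not be integrable. Hence the mean value inequality starts at $\varepsilon>0$,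
  -- and continuity of `G` lets $\varepsilon\to0$.
  have hmv : ∀ ε : ℝ, 0 < ε → ‖G r - G ε‖ ≤ L * ‖r - ε‖ := fun ε hε =>
    (convex_Ioi (0 : ℝ)).norm_image_sub_le_of_norm_hasDerivWithin_le
      (fun x hx => (hG' x hx).hasDerivWithinAt) hGL hε hr
  have hG0 : G 0 = 0 := by
    simp only [hG, zero_mul, Real.arctan_zero, Complex.ofReal_zero, integral_zero]
  have hl : Tendsto (fun ε : ℝ => ‖G r - G ε‖) (𝓝[>] 0) (𝓝 ‖G r - G 0‖) :=
    ((continuous_const.sub hcont).norm.tendsto 0).mono_left nhdsWithin_le_nhds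
  have hr' : Tendsto (fun ε : ℝ => L * ‖r - ε‖) (𝓝[>] 0) (𝓝 (L * ‖r - 0‖)) :=
    (Continuous.tendsto (by fun_prop) 0).mono_left nhdsWithin_le_nhds
  have := le_of_tendsto_of_tendsto hl hr'
    (by filter_upwards [self_mem_nhdsWithin] with ε hε using hmv ε hε)
  rwa [hG0, sub_zero, sub_zero, Real.norm_of_nonneg hr.le] at this

end ArctanIntegral

section ArctanCommutator

/-! ### Commutators with `arctan (r D)` -/

/-- The function `x ↦ arctan (r x)` on `[-∞, ∞]`. -/
def arctanC {r : ℝ} (hr : 0 < r) : C(EReal, ℂ) :=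
  CS.toC ⟨fun x => ((Real.arctan (r * x) : ℝ) : ℂ), by fun_prop,
    ⟨((Real.pi / 2 : ℝ) : ℂ), (Complex.continuous_ofReal.tendsto _).comp
      ((tendsto_nhds_of_tendsto_nhdsWithin Real.tendsto_arctan_atTop).comp
        (tendsto_id.const_mul_atTop hr))⟩,
    ⟨((-(Real.pi / 2) : ℝ) : ℂ), (Complex.continuous_ofReal.tendsto _).comp
      ((tendsto_nhds_of_tendsto_nhdsWithin Real.tendsto_arctan_atBot).comp
        (tendsto_id.const_mul_atBot hr))⟩⟩

theorem arctanC_coe {r : ℝ} (hr : 0 < r) (x : ℝ) :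
    arctanC hr x = ((Real.arctan (r * x) : ℝ) : ℂ) := rfl

theorem arctanC_top {r : ℝ} (hr : 0 < r) : arctanC hr ⊤ = ((Real.pi / 2 : ℝ) : ℂ) :=
  tendsto_nhds_unique (((arctanC hr).continuous.tendsto ⊤).comp EReal.tendsto_coe_atTop)
    ((Complex.continuous_ofReal.tendsto _).comp
      ((tendsto_nhds_of_tendsto_nhdsWithin Real.tendsto_arctan_atTop).comp
        (tendsto_id.const_mul_atTop hr)))

theorem arctanC_bot {r : ℝ} (hr : 0 < r) : arctanC hr ⊥ = ((-(Real.pi / 2) : ℝ) : ℂ) :=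
  tendsto_nhds_unique (((arctanC hr).continuous.tendsto ⊥).comp EReal.tendsto_coe_atBot)
    ((Complex.continuous_ofReal.tendsto _).comp
      ((tendsto_nhds_of_tendsto_nhdsWithin Real.tendsto_arctan_atBot).comp
        (tendsto_id.const_mul_atBot hr)))

theorem abs_arctan_sub_arctan_le (x y : ℝ) : |Real.arctan x - Real.arctan y| ≤ |x - y| := by
  have := convex_univ.norm_image_sub_le_of_norm_hasDerivWithin_le (f := Real.arctan) (C := 1)
    (fun x _ => (Real.hasDerivAt_arctan x).hasDerivWithinAt) (fun x _ => ?_)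
    (Set.mem_univ y) (Set.mem_univ x)
  · simpa using this
  · rw [Real.norm_of_nonneg (by positivity), one_div]
    exact inv_le_one_of_one_le₀ (by nlinarith [sq_nonneg x])

/-- The commutator of a Lipschitz function of `M` with a translation. -/
theorem norm_mulHom_translation_sub_le {a : C(EReal, ℂ)} {K : ℝ}
    (ha : ∀ x y : ℝ, ‖a x - a y‖ ≤ K * |x - y|) (t : ℝ) (u : L2R) :
    ‖mulHom a (translation t u) - translation t (mulHom a u)‖ ≤ K * |t| * ‖u‖ := by
  rw [← LinearIsometry.norm_map (translation t) u]
  refine Lp.norm_le_mul_norm_of_ae_le_mul ?_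
  filter_upwards [Lp.coeFn_sub (mulHom a (translation t u)) (translation t (mulHom a u)),
    mulHom_apply_ae a (translation t u), translation_ae t (mulHom a u), translation_ae t u,
    (measurePreserving_sub_right volume t).quasiMeasurePreserving.ae (mulHom_apply_ae a u)]
    with x h1 h2 h3 h4 h5
  rw [h1, Pi.sub_apply, h2, h3, h4, h5, ← sub_mul, norm_mul]
  refine mul_le_mul_of_nonneg_right ((ha x (x - t)).trans (le_of_eq ?_)) (norm_nonneg _)
  rw [sub_sub_cancel]

/-- The matrix coefficients of $[a(M),b(D)]$ are $\int b\,\varphi$ with a density $\varphi$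
independent of $b$. The choice $b(\xi)=e^{-it\xi}$ gives commutators with translations, of norm at
most $K|t|$ for a $K$-Lipschitz $a$; this is the hypothesis of `norm_integral_arctan_mul_le`. -/
theorem norm_commutator_arctan_le {a : C(EReal, ℂ)} {K : ℝ} (hK : 0 ≤ K)
    (ha : ∀ x y : ℝ, ‖a x - a y‖ ≤ K * |x - y|) {r : ℝ} (hr : 0 < r) :
    ‖mulHom a * fourHom (arctanC hr) - fourHom (arctanC hr) * mulHom a‖ ≤ K * r := by
  set B := fourHom (arctanC hr)
  have hadj : ∀ u v : L2R, ⟪v, mulHom a u⟫ = ⟪mulHom (star a) v, u⟫ := fun u v => by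
    rw [map_star, ContinuousLinearMap.star_eq_adjoint, ContinuousLinearMap.adjoint_inner_left]
  have key : ∀ u v : L2R, ‖⟪v, (mulHom a * B - B * mulHom a) u⟫‖ ≤ K * r * ‖u‖ * ‖v‖ := by
    intro u v
    set φ : ℝ → ℂ := fun ξ => ⟪fourier (mulHom (star a) v) ξ, fourier u ξ⟫
      - ⟪fourier v ξ, fourier (mulHom a u) ξ⟫ with hφ
    have hi1 : Integrable (fun ξ => ⟪fourier (mulHom (star a) v) ξ, fourier u ξ⟫) volume :=
      L2.integrable_inner _ _
    have hi2 : Integrable (fun ξ => ⟪fourier v ξ, fourier (mulHom a u) ξ⟫) volume :=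
      L2.integrable_inner _ _
    have hbd : ∀ (ψ : ℝ → ℂ), Integrable ψ volume → ∀ t : ℝ,
        Integrable (fun ξ : ℝ => Complex.exp (-Complex.I * t * ξ) * ψ ξ) volume := by
      intro ψ hψ t
      refine hψ.bdd_mul (c := 1) (by fun_prop) (Eventually.of_forall fun ξ => ?_)
      have := norm_exp_I_mul (-t) ξ
      push_cast at this
      rw [mul_neg, ← neg_mul] at this
      exact this.le
    have h1 : ∀ t : ℝ, ‖∫ ξ : ℝ, Complex.exp (-Complex.I * t * ξ) * φ ξ‖
        ≤ K * ‖u‖ * ‖v‖ * |t| := by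
      intro t
      have h2 : ∫ ξ : ℝ, Complex.exp (-Complex.I * t * ξ) * φ ξ
          = ⟪v, mulHom a (translation t u) - translation t (mulHom a u)⟫ := by
        rw [inner_sub_right, hadj, inner_translation, inner_translation,
          ← integral_sub (hbd _ hi1 t) (hbd _ hi2 t)]
        simp only [hφ, mul_sub]
      rw [h2]
      refine (norm_inner_le_norm _ _).trans ?_
      have := mul_le_mul_of_nonneg_left (norm_mulHom_translation_sub_le ha t u) (norm_nonneg v)
      linarith
    have h3 : ⟪v, (mulHom a * B - B * mulHom a) u⟫
        = ∫ ξ : ℝ, ((Real.arctan (r * ξ) : ℝ) : ℂ) * φ ξ := by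
      have hbd' : ∀ (ψ : ℝ → ℂ), Integrable ψ volume →
          Integrable (fun ξ : ℝ => arctanC hr ξ * ψ ξ) volume := fun ψ hψ =>
        hψ.bdd_mul (c := ‖arctanC hr‖) (continuous_coe_real _).aestronglyMeasurable
          (Eventually.of_forall fun ξ => (arctanC hr).norm_coe_le_norm _)
      rw [sub_apply, mul_apply_eq_comp, mul_apply_eq_comp, inner_sub_right, hadj, inner_fourHom,
        inner_fourHom, ← integral_sub (hbd' _ hi1) (hbd' _ hi2)]
      simp only [hφ, mul_sub, arctanC_coe]
    rw [h3]
    have := norm_integral_arctan_mul_le (φ := φ) (hi1.sub hi2) h1 hr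
    linarith
  refine ContinuousLinearMap.opNorm_le_bound _ (by positivity) fun u => ?_
  -- Testing against the image of `u` itself turns the weak bound into a norm bound.
  have h4 := key u ((mulHom a * B - B * mulHom a) u)
  rw [inner_self_eq_norm_sq_to_K, norm_pow, RCLike.norm_ofReal, abs_norm, sq] at h4
  rcases (norm_nonneg ((mulHom a * B - B * mulHom a) u)).eq_or_lt with h0 | h0
  · rw [← h0]; positivity
  · exact le_of_mul_le_mul_right h4 h0

/-- Since $\arctan x-\arctan(rx)$ vanishes at $\pm\infty$ for $r>0$, the commutator of these
differences in $M$ and in $D$ is compact. The remaining terms are $[A,B']$, $[A',B]$ and $[A',B']$,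
of norms at most $r$, $r$ and $r^2$. -/
theorem isCompactOperator_commutator_arctan :
    IsCompactOperator (mulHom (arctanC one_pos) * fourHom (arctanC one_pos)
      - fourHom (arctanC one_pos) * mulHom (arctanC one_pos) : L2R →L[ℂ] L2R) := by
  have hcl : IsClosed {T : L2R →L[ℂ] L2R | IsCompactOperator T} :=
    isClosed_setOfPred_isCompactOperator
  have hlip : ∀ {r : ℝ} (hr : 0 < r) (x y : ℝ), ‖arctanC hr x - arctanC hr y‖ ≤ r * |x - y| := by
    intro r hr x y
    rw [arctanC_coe, arctanC_coe, ← Complex.ofReal_sub, Complex.norm_real]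
    refine (abs_arctan_sub_arctan_le _ _).trans (le_of_eq ?_)
    rw [← mul_sub, abs_mul, abs_of_pos hr]
  refine hcl.closure_subset (Metric.mem_closure_iff.2 fun ε hε => ?_)
  -- Then $r+r+r^2\le3r\le3\varepsilon/4<\varepsilon$.
  set r := min 1 (ε / 4) with hr
  have hr0 : 0 < r := lt_min one_pos (by positivity)
  set A := mulHom (arctanC one_pos)
  set B := fourHom (arctanC one_pos)
  set A' := mulHom (arctanC hr0)
  set B' := fourHom (arctanC hr0)
  have ht : (arctanC one_pos - arctanC hr0) ⊤ = 0 := by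
    rw [ContinuousMap.sub_apply, arctanC_top, arctanC_top, sub_self]
  have hb : (arctanC one_pos - arctanC hr0) ⊥ = 0 := by
    rw [ContinuousMap.sub_apply, arctanC_bot, arctanC_bot, sub_self]
  refine ⟨(A - A') * (B - B') - (B - B') * (A - A'), ?_, ?_⟩
  · have h1 := isCompactOperator_mulHom_mul_fourHom ht hb ht hb
    have h2 := isCompactOperator_fourHom_mul_mulHom ht hb ht hb
    rw [map_sub, map_sub] at h1 h2
    exact IsCompactOperator.sub h1 h2
  · have e : A * B - B * A - ((A - A') * (B - B') - (B - B') * (A - A'))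
        = (A * B' - B' * A) + ((A' * B - B * A') - (A' * B' - B' * A')) := by noncomm_ring
    rw [dist_eq_norm, e]
    have n1 := norm_commutator_arctan_le zero_le_one (hlip one_pos) hr0
    have n2 := norm_commutator_arctan_le hr0.le (hlip hr0) one_pos
    have n3 := norm_commutator_arctan_le hr0.le (hlip hr0) hr0
    have n4 := norm_add_le (A * B' - B' * A) ((A' * B - B * A') - (A' * B' - B' * A'))
    have n5 := norm_sub_le (A' * B - B * A') (A' * B' - B' * A')
    have r1 : r ≤ 1 := min_le_left _ _
    have r2 : r ≤ ε / 4 := min_le_right _ _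
    nlinarith

end ArctanCommutator

end SymbolAlgebra

namespace SymbolAlgebra

section Commutators

/-! ### Compactness of the commutators -/

/-- From $[ST,X]=S[T,X]+[S,X]T$, the operators commuting with $X$ modulo compacts form a closed
algebra. As $X$ need not be self-adjoint, the induction carries $S$ and $S^*$ together, starting
from a self-adjoint generating set. -/
theorem isCompactOperator_commutator_of_adjoin {H : Type*} [NormedAddCommGroup H]
    [InnerProductSpace ℂ H] [CompleteSpace H] {G : Set (H →L[ℂ] H)} {X : H →L[ℂ] H}
    (hG : ∀ g ∈ G, star g ∈ G) (h : ∀ g ∈ G, IsCompactOperator (g * X - X * g : H →L[ℂ] H))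
    {S : H →L[ℂ] H} (hS : S ∈ (StarAlgebra.adjoin ℂ G).topologicalClosure) :
    IsCompactOperator (S * X - X * S : H →L[ℂ] H) := by
  have hcl : IsClosed {T : H →L[ℂ] H | IsCompactOperator T} := isClosed_setOfPred_isCompactOperator
  have key : ∀ S ∈ StarAlgebra.adjoin ℂ G, IsCompactOperator (S * X - X * S : H →L[ℂ] H) ∧
      IsCompactOperator (star S * X - X * star S : H →L[ℂ] H) := by
    intro S hS
    have hmul : ∀ S T : H →L[ℂ] H, IsCompactOperator (S * X - X * S : H →L[ℂ] H) →
        IsCompactOperator (T * X - X * T : H →L[ℂ] H) →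
        IsCompactOperator ((S * T) * X - X * (S * T) : H →L[ℂ] H) := by
      intro S T h1 h2
      have e : (S * T) * X - X * (S * T) = S * (T * X - X * T) + (S * X - X * S) * T := by
        noncomm_ring
      rw [e]
      exact IsCompactOperator.add (h2.clm_comp S) (h1.comp_clm T)
    induction hS using StarAlgebra.adjoin_induction with
    | mem g hg => exact ⟨h g hg, h _ (hG g hg)⟩
    | algebraMap c =>
      have h0 : ∀ c : ℂ, algebraMap ℂ (H →L[ℂ] H) c * X - X * algebraMap ℂ (H →L[ℂ] H) c = 0 :=
        fun c => sub_eq_zero.2 (Algebra.commutes c X)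
      rw [← algebraMap_star_comm, h0, h0]
      exact ⟨isCompactOperator_zero, isCompactOperator_zero⟩
    | add S T _ _ h1 h2 =>
      refine ⟨?_, ?_⟩
      · rw [show (S + T) * X - X * (S + T) = (S * X - X * S) + (T * X - X * T) by noncomm_ring]
        exact IsCompactOperator.add h1.1 h2.1
      · rw [star_add, show (star S + star T) * X - X * (star S + star T)
          = (star S * X - X * star S) + (star T * X - X * star T) by noncomm_ring]
        exact IsCompactOperator.add h1.2 h2.2
    | mul S T _ _ h1 h2 =>
      rw [star_mul]
      exact ⟨hmul _ _ h1.1 h2.1, hmul _ _ h2.2 h1.2⟩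
    | star S _ h1 =>
      rw [star_star]
      exact ⟨h1.2, h1.1⟩
  have hc : Continuous fun S : H →L[ℂ] H => S * X - X * S := by fun_prop
  exact closure_minimal (fun S hS => (key S hS).1) (hcl.preimage hc) hS

theorem arctanC_re_lt {x y : EReal} (h : x < y) :
    (arctanC one_pos x).re < (arctanC one_pos y).re := by
  induction x with
  | coe x =>
    induction y with
    | coe y =>
      rw [arctanC_coe, arctanC_coe, Complex.ofReal_re, Complex.ofReal_re, one_mul, one_mul]
      exact Real.arctan_strictMono (EReal.coe_lt_coe_iff.1 h)
    | top =>
      rw [arctanC_coe, arctanC_top, Complex.ofReal_re, Complex.ofReal_re]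
      exact Real.arctan_lt_pi_div_two _
    | bot => exact absurd h not_lt_bot
  | top => exact absurd h not_top_lt
  | bot =>
    induction y with
    | coe y =>
      rw [arctanC_coe, arctanC_bot, Complex.ofReal_re, Complex.ofReal_re]
      exact Real.neg_pi_div_two_lt_arctan _
    | top =>
      rw [arctanC_top, arctanC_bot, Complex.ofReal_re, Complex.ofReal_re]
      linarith [Real.pi_pos]
    | bot => exact absurd h (lt_irrefl _)

/-- The function `arctan` generates the algebra of the continuous functions on `[-∞, ∞]`. -/
theorem topologicalClosure_adjoin_arctanC :
    (StarAlgebra.adjoin ℂ {arctanC one_pos}).topologicalClosure = ⊤ := by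
  refine ContinuousMap.starSubalgebra_topologicalClosure_eq_top_of_separatesPoints _ ?_
  intro x y hxy
  refine ⟨arctanC one_pos, ⟨arctanC one_pos, StarAlgebra.subset_adjoin ℂ _ rfl, rfl⟩, fun h => ?_⟩
  rcases lt_or_gt_of_ne hxy with h1 | h1
  · exact (arctanC_re_lt h1).ne (congr_arg Complex.re h)
  · exact (arctanC_re_lt h1).ne (congr_arg Complex.re h.symm)

theorem eq_of_eq_coe {f g : C(EReal, ℂ)} (h : ∀ x : ℝ, f x = g x) : f = g :=
  DFunLike.coe_injective (denseRange_coe_EReal.equalizer f.continuous g.continuous (funext h))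

theorem star_arctanC {r : ℝ} (hr : 0 < r) : star (arctanC hr) = arctanC hr := by
  refine eq_of_eq_coe fun x => ?_
  rw [ContinuousMap.star_apply, arctanC_coe]
  exact Complex.conj_ofReal _

/-- By continuity, the range of `π` lies in the closed $*$-algebra generated by the image of
$\arctan$, so the generator decides. -/
theorem isCompactOperator_commutator_of_arctanC {π : C(EReal, ℂ) →⋆ₐ[ℂ] (L2R →L[ℂ] L2R)}
    (hπ : Continuous π) {X : L2R →L[ℂ] L2R} (h : IsCompactOperator
      (π (arctanC one_pos) * X - X * π (arctanC one_pos) : L2R →L[ℂ] L2R)) (f : C(EReal, ℂ)) :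
    IsCompactOperator (π f * X - X * π f : L2R →L[ℂ] L2R) := by
  refine isCompactOperator_commutator_of_adjoin (G := {π (arctanC one_pos)}) ?_ ?_ ?_
  · rintro _ rfl
    rw [← map_star, star_arctanC]
    rfl
  · rintro _ rfl
    exact h
  · have h1 : f ∈ (StarAlgebra.adjoin ℂ {arctanC one_pos}).topologicalClosure := by
      rw [topologicalClosure_adjoin_arctanC]
      trivial
    have h2 : π f ∈ closure (π '' (StarAlgebra.adjoin ℂ {arctanC one_pos} : Set C(EReal, ℂ))) :=
      image_closure_subset_closure_image hπ ⟨f, h1, rfl⟩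
    have h3 : π '' (StarAlgebra.adjoin ℂ {arctanC one_pos} : Set C(EReal, ℂ))
        = (StarAlgebra.adjoin ℂ {π (arctanC one_pos)} : Set (L2R →L[ℂ] L2R)) := by
      rw [← StarSubalgebra.coe_map, StarAlgHom.map_adjoin, Set.image_singleton]
    rw [h3] at h2
    exact h2

/-- The reduction to $\arctan$ is applied twice: first in $M$ against the fixed operator $\arctan
D$, then in $D$ against the fixed operator $f(M)$. -/
theorem isCompactOperator_commutator_mulHom_fourHom (f g : C(EReal, ℂ)) :
    IsCompactOperator (mulHom f * fourHom g - fourHom g * mulHom f : L2R →L[ℂ] L2R) := by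
  have h1 := isCompactOperator_commutator_of_arctanC continuous_mulHom
    isCompactOperator_commutator_arctan f
  have h2 := isCompactOperator_commutator_of_arctanC continuous_fourHom (X := mulHom f) (by
    have := IsCompactOperator.neg h1
    rw [← FunLike.coe_neg, neg_sub] at this
    exact this) g
  have := IsCompactOperator.neg h2
  rw [← FunLike.coe_neg, neg_sub] at this
  exact this

/-- Compactness spreads from pairs of generators one argument at a time: to all `T` against a
generator, then to all `S` against `T`. -/
theorem commutator_mem_compactIdeal (S T : algC) : S * T - T * S ∈ compactIdeal := by
  set G : Set (L2R →L[ℂ] L2R) := Set.range multiplication ∪ Set.range fourierMultiplier with hG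
  have hneg : ∀ {A B : L2R →L[ℂ] L2R}, IsCompactOperator (A * B - B * A : L2R →L[ℂ] L2R) →
      IsCompactOperator (B * A - A * B : L2R →L[ℂ] L2R) := by
    intro A B h
    have := IsCompactOperator.neg h
    rwa [← FunLike.coe_neg, neg_sub] at this
  have hGs : ∀ g ∈ G, star g ∈ G := by
    rintro _ (⟨a, rfl⟩ | ⟨a, rfl⟩)
    · rw [← mulHom_toC, ← map_star]
      exact Or.inl ⟨_, rfl⟩
    · rw [← fourHom_toC, ← map_star]
      exact Or.inr ⟨_, rfl⟩
  have hGG : ∀ g ∈ G, ∀ g' ∈ G, IsCompactOperator (g * g' - g' * g : L2R →L[ℂ] L2R) := by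
    rintro _ (⟨a, rfl⟩ | ⟨a, rfl⟩) _ (⟨b, rfl⟩ | ⟨b, rfl⟩)
    · rw [← mulHom_toC, ← mulHom_toC, ← map_mul, ← map_mul, mul_comm, sub_self]
      exact isCompactOperator_zero
    · exact isCompactOperator_commutator_mulHom_fourHom (CS.toC a) (CS.toC b)
    · exact hneg (isCompactOperator_commutator_mulHom_fourHom (CS.toC b) (CS.toC a))
    · rw [← fourHom_toC, ← fourHom_toC, ← map_mul, ← map_mul, mul_comm, sub_self]
      exact isCompactOperator_zero
  refine isCompactOperator_commutator_of_adjoin hGs (fun g hg => ?_) S.2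
  exact hneg (isCompactOperator_commutator_of_adjoin hGs (fun g' hg' => hGG g' hg' g hg) T.2)

theorem isClosed_algC : IsClosed (algC : Set (L2R →L[ℂ] L2R)) :=
  StarSubalgebra.isClosed_topologicalClosure _

instance completeSpace_algC : CompleteSpace algC := isClosed_algC.completeSpace_coe

theorem isClosed_compactIdeal : IsClosed (compactIdeal : Set algC) :=
  (isClosed_setOfPred_isCompactOperator (M₁ := L2R) (M₂ := L2R) (σ₁₂ := RingHom.id ℂ)).preimage
    continuous_subtype_val

theorem commutatorIdeal_le_compactIdeal : commutatorIdeal algC ≤ compactIdeal :=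
  sInf_le ⟨inferInstance, isClosed_compactIdeal, commutator_mem_compactIdeal⟩

end Commutators

section CommutatorIdeal

/-! ### The commutator ideal contains the compact operators -/

open InnerProductSpace

theorem isClosed_commutatorIdeal (A : Type*) [NormedRing A] [NormedAlgebra ℂ A] :
    IsClosed (commutatorIdeal A : Set A) := by
  rw [commutatorIdeal, Submodule.coe_sInf]
  exact isClosed_biInter fun I hI => hI.2.1

theorem commutator_mem_commutatorIdeal {A : Type*} [NormedRing A] [NormedAlgebra ℂ A] (a b : A) :
    a * b - b * a ∈ commutatorIdeal A :=
  Submodule.mem_sInf.2 fun _ hI => hI.2.2 a b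

/-- The commutator ideal as a subspace of the space of all operators. -/
def commutatorSubspace : Submodule ℂ (L2R →L[ℂ] L2R) :=
  ((commutatorIdeal algC).restrictScalars ℂ).map algC.toSubalgebra.val.toLinearMap

theorem coe_commutatorSubspace : (commutatorSubspace : Set (L2R →L[ℂ] L2R))
    = ((↑) : algC → (L2R →L[ℂ] L2R)) '' (commutatorIdeal algC : Set algC) := rfl

theorem isClosed_commutatorSubspace : IsClosed (commutatorSubspace : Set (L2R →L[ℂ] L2R)) :=
  isClosed_algC.isClosedEmbedding_subtypeVal.isClosedMap _ (isClosed_commutatorIdeal algC)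

theorem mul_mem_commutatorSubspace {S T : L2R →L[ℂ] L2R} (hS : S ∈ commutatorSubspace)
    (hT : T ∈ commutatorSubspace) : S * T ∈ commutatorSubspace := by
  obtain ⟨S, hS, rfl⟩ := hS
  obtain ⟨T, hT, rfl⟩ := hT
  exact ⟨S * T, (commutatorIdeal algC).mul_mem_left S hT, rfl⟩

/-- The relations give $f(M)[a(M),b(D)]g(M)=f(M)b(D)g(M)$, so every such sandwich lies in the
commutator ideal, and hence so do the rank one limits. -/
theorem rankOne_mem_commutatorSubspace_of_separated {f g a : C(EReal, ℂ)} (hfa : f * a = f)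
    (hag : a * g = 0) (hf : MemLp (fun x : ℝ => f x) 2 volume)
    (hg : MemLp (fun x : ℝ => star (g x)) 2 volume) :
    rankOne ℂ hf.toLp hg.toLp ∈ commutatorSubspace := by
  refine rankOne_mem_of_mulHom_mul_fourHom_mul_mulHom_mem isClosed_commutatorSubspace hf hg
    fun b => ?_
  let m : C(EReal, ℂ) → algC := fun f => multC (CS.ofC f)
  refine ⟨m f * (m a * fourC (CS.ofC b) - fourC (CS.ofC b) * m a) * m g,
    (commutatorIdeal algC).mul_mem_right _ ((commutatorIdeal algC).mul_mem_left _
      (commutator_mem_commutatorIdeal _ _)), ?_⟩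
  change mulHom f * (mulHom a * fourHom b - fourHom b * mulHom a) * mulHom g = _
  rw [mul_sub, sub_mul, ← mul_assoc, ← map_mul, hfa, ← mul_assoc (mulHom f),
    mul_assoc (mulHom f * fourHom b) (mulHom a), ← map_mul, hag, map_zero, mul_zero, sub_zero]

/-- The supports of $f$ and $g$ may overlap, so a bump $k$ to the right of both is interposed: the
operators $f\otimes k$ and $k\otimes g$ come from separated pairs, and their product is
$\|k\|^2\,f\otimes g$. -/
theorem rankOne_mem_commutatorSubspace_of_hasCompactSupport {f g : ℝ → ℂ} (hf : Continuous f)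
    (hfs : HasCompactSupport f) (hg : Continuous g) (hgs : HasCompactSupport g)
    (hf2 : MemLp f 2 volume) (hg2 : MemLp g 2 volume) :
    rankOne ℂ hf2.toLp hg2.toLp ∈ commutatorSubspace := by
  obtain ⟨R₁, hR₁⟩ := hfs.isCompact.bddAbove
  obtain ⟨R₂, hR₂⟩ := hgs.isCompact.bddAbove
  set R := max R₁ R₂ with hR
  have hf0 : ∀ x, R < x → f x = 0 := fun x hx => by
    by_contra hne
    exact absurd (hR₁ (subset_tsupport f hne)) (not_le.2 ((le_max_left _ _).trans_lt hx))
  have hg0 : ∀ x, R < x → g x = 0 := fun x hx => by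
    by_contra hne
    exact absurd (hR₂ (subset_tsupport g hne)) (not_le.2 ((le_max_right _ _).trans_lt hx))
  -- Centre $R+3$ and outer radius $2$ make the bump vanish up to $R+1$, leaving $[R,R+1]$ for the
  -- cutoff `a` to descend from $1$ to $0$.
  let φ : ContDiffBump (R + 3) := ⟨1, 2, one_pos, one_lt_two⟩
  let k : ℝ → ℂ := fun x => ((φ x : ℝ) : ℂ)
  have hk : Continuous k := Complex.continuous_ofReal.comp φ.continuous
  have hks : HasCompactSupport k := φ.hasCompactSupport.comp_left Complex.ofReal_zero
  have hk0 : ∀ x, x ≤ R + 1 → k x = 0 := fun x hx => by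
    have : φ x = 0 := φ.zero_of_le_dist (by
      rw [Real.dist_eq, abs_of_nonpos (by linarith)]
      change (2 : ℝ) ≤ _
      linarith)
    simp [k, this]
  have hk2 : MemLp k 2 volume := hk.memLp_of_hasCompactSupport hks
  have hkstar : (fun x => star (k x)) = k := funext fun x => Complex.conj_ofReal _
  let a : C(EReal, ℂ) := CS.toC ⟨fun x => ((max 0 (min 1 (R + 1 - x)) : ℝ) : ℂ), by fun_prop,
    ⟨0, tendsto_const_nhds.congr' (by
      filter_upwards [eventually_ge_atTop (R + 1)] with x hx
      rw [max_eq_left ((min_le_right _ _).trans (by linarith)), Complex.ofReal_zero])⟩,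
    ⟨1, tendsto_const_nhds.congr' (by
      filter_upwards [eventually_le_atBot R] with x hx
      rw [min_eq_left (by linarith), max_eq_right zero_le_one, Complex.ofReal_one])⟩⟩
  have ha : ∀ x : ℝ, a x = ((max 0 (min 1 (R + 1 - x)) : ℝ) : ℂ) := fun x => rfl
  have ha1 : ∀ x : ℝ, x ≤ R → a x = 1 := fun x hx => by
    rw [ha, min_eq_left (by linarith), max_eq_right zero_le_one, Complex.ofReal_one]
  have ha0 : ∀ x : ℝ, R + 1 ≤ x → a x = 0 := fun x hx => by
    rw [ha, max_eq_left ((min_le_right _ _).trans (by linarith)), Complex.ofReal_zero]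
  have hgs' : HasCompactSupport fun x => star (g x) := hgs.comp_left (star_zero ℂ)
  let F := ofCompactSupport f hf hfs
  let K := ofCompactSupport k hk hks
  -- The conjugate compensates for the conjugate-linear second slot of the rank one operator.
  let G := ofCompactSupport (fun x => star (g x)) hg.star hgs'
  have e1 : F * a = F := eq_of_eq_coe fun x => by
    rcases le_or_gt x R with hx | hx
    · rw [ContinuousMap.mul_apply, ha1 x hx, mul_one]
    · change f x * a x = f x
      rw [hf0 x hx, zero_mul]
  have e2 : a * K = 0 := eq_of_eq_coe fun x => by
    change a x * k x = 0
    rcases le_or_gt x (R + 1) with hx | hx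
    · rw [hk0 x hx, mul_zero]
    · rw [ha0 x hx.le, zero_mul]
  have e3 : K * (1 - a) = K := by
    rw [mul_sub, mul_one, mul_comm, e2, sub_zero]
  have e4 : (1 - a) * G = 0 := eq_of_eq_coe fun x => by
    change (1 - a x) * star (g x) = 0
    rcases le_or_gt x R with hx | hx
    · rw [ha1 x hx, sub_self, zero_mul]
    · rw [hg0 x hx, star_zero, mul_zero]
  have hK2 : MemLp (fun x : ℝ => star (K x)) 2 volume := by
    change MemLp (fun x => star (k x)) 2 volume
    rwa [hkstar]
  have hG2 : MemLp (fun x : ℝ => star (G x)) 2 volume := by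
    change MemLp (fun x => star (star (g x))) 2 volume
    simpa only [star_star] using hg2
  have m1 := rankOne_mem_commutatorSubspace_of_separated e1 e2 hf2 hK2
  have m2 := rankOne_mem_commutatorSubspace_of_separated e3 e4 hk2 hG2
  have t1 : hK2.toLp = hk2.toLp := by
    congr 1
  have t2 : hG2.toLp = hg2.toLp := by
    congr 1
    exact funext fun x => star_star _
  rw [t1] at m1
  rw [t2] at m2
  have m3 : rankOne ℂ hf2.toLp hk2.toLp * rankOne ℂ hk2.toLp hg2.toLp ∈ commutatorSubspace :=
    mul_mem_commutatorSubspace m1 m2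
  have e5 : rankOne ℂ hf2.toLp hk2.toLp * rankOne ℂ hk2.toLp hg2.toLp
      = (⟪hk2.toLp, hk2.toLp⟫ : ℂ) • rankOne ℂ hf2.toLp hg2.toLp := rankOne_comp_rankOne _ _ _ _
  have hne : (⟪hk2.toLp, hk2.toLp⟫ : ℂ) ≠ 0 := by
    rw [Ne, inner_self_eq_zero]
    intro h0
    have h1 : k = fun _ => 0 := (Continuous.ae_eq_iff_eq volume hk continuous_const).1
      (hk2.coeFn_toLp.symm.trans (h0 ▸ Lp.coeFn_zero ℂ 2 volume))
    have h2 : φ (R + 3) = 1 := φ.one_of_mem_closedBall (by simp [φ.rIn_pos.le])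
    have h3 := congr_fun h1 (R + 3)
    simp [k, h2] at h3
  have m4 := commutatorSubspace.smul_mem (⟪hk2.toLp, hk2.toLp⟫ : ℂ)⁻¹ m3
  rwa [e5, smul_smul, inv_mul_cancel₀ hne, one_smul] at m4

theorem rankOne_mem_commutatorSubspace (u v : L2R) : rankOne ℂ u v ∈ commutatorSubspace := by
  have hd := Lp.dense_hasCompactSupport_contDiff (E := ℝ) (F := ℂ) (μ := volume) (p := 2)
    ENNReal.ofNat_ne_top
  have key : ∀ u ∈ {f : L2R | ∃ g : ℝ → ℂ, f =ᵐ[volume] g ∧ HasCompactSupport g ∧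
      ContDiff ℝ (⊤ : ℕ∞) g}, ∀ v ∈ {f : L2R | ∃ g : ℝ → ℂ, f =ᵐ[volume] g ∧ HasCompactSupport g ∧
      ContDiff ℝ (⊤ : ℕ∞) g}, rankOne ℂ u v ∈ commutatorSubspace := by
    rintro u ⟨f, huf, hfs, hf⟩ v ⟨g, hvg, hgs, hg⟩
    have hf2 : MemLp f 2 volume := hf.continuous.memLp_of_hasCompactSupport hfs
    have hg2 : MemLp g 2 volume := hg.continuous.memLp_of_hasCompactSupport hgs
    have e1 : u = hf2.toLp := Lp.ext (huf.trans hf2.coeFn_toLp.symm)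
    have e2 : v = hg2.toLp := Lp.ext (hvg.trans hg2.coeFn_toLp.symm)
    rw [e1, e2]
    exact rankOne_mem_commutatorSubspace_of_hasCompactSupport hf.continuous hfs hg.continuous hgs
      hf2 hg2
  have h1 : ∀ u ∈ {f : L2R | ∃ g : ℝ → ℂ, f =ᵐ[volume] g ∧ HasCompactSupport g ∧
      ContDiff ℝ (⊤ : ℕ∞) g}, ∀ v, rankOne ℂ u v ∈ commutatorSubspace := fun u hu v =>
    closure_minimal (key u hu) (isClosed_commutatorSubspace.preimage
      (continuous_rankOne continuous_const continuous_id)) (hd v)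
  exact closure_minimal (fun u hu => h1 u hu v) (isClosed_commutatorSubspace.preimage
    (continuous_rankOne continuous_id continuous_const)) (hd u)

theorem image_commutatorIdeal : ((↑) : algC → (L2R →L[ℂ] L2R)) '' (commutatorIdeal algC : Set algC)
    = {T : L2R →L[ℂ] L2R | IsCompactOperator T} := by
  refine Set.Subset.antisymm ?_ fun T hT => ?_
  · rintro _ ⟨T, hT, rfl⟩
    exact commutatorIdeal_le_compactIdeal hT
  · rw [← coe_commutatorSubspace]
    exact mem_of_rankOne_mem isClosed_commutatorSubspace rankOne_mem_commutatorSubspace hT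

theorem exists_coe_eq_of_isCompactOperator {T : L2R →L[ℂ] L2R} (hT : IsCompactOperator T) :
    ∃ S ∈ commutatorIdeal algC, (S : L2R →L[ℂ] L2R) = T := by
  have h : T ∈ {T : L2R →L[ℂ] L2R | IsCompactOperator T} := hT
  rwa [← image_commutatorIdeal] at h

theorem commutatorIdeal_eq_compactIdeal : commutatorIdeal algC = compactIdeal := by
  refine le_antisymm commutatorIdeal_le_compactIdeal fun T hT => ?_
  obtain ⟨S, hS, hST⟩ := exists_coe_eq_of_isCompactOperator hT
  rwa [← Subtype.ext hST]

end CommutatorIdeal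

end SymbolAlgebra

namespace SymbolAlgebra

section SymbolValues

/-! ### Compact products of operators which commute with the translations -/

theorem norm_sq_eq_integral (u : L2R) : ‖u‖ ^ 2 = ∫ x : ℝ, ‖u x‖ ^ 2 := by
  have h := inner_self_eq_norm_sq_to_K (𝕜 := ℂ) u
  rw [L2.inner_def] at h
  have h2 : ∫ x : ℝ, (⟪u x, u x⟫ : ℂ) = ((∫ x : ℝ, ‖u x‖ ^ 2 : ℝ) : ℂ) := by
    rw [← integral_complex_ofReal]
    refine integral_congr_ae (Eventually.of_forall fun x => ?_)
    simp only [inner_self_eq_norm_sq_to_K]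
    norm_cast
  rw [h2, ← RCLike.ofReal_pow] at h
  exact Complex.ofReal_injective h.symm

/-- A change of variables turns the squared norm into $\int|a(x+t)-a(s)|^2|u(x)|^2\,dx$. Dominated
convergence applies, for which the filter must be countably generated. -/
theorem tendsto_norm_mulHom_translation_sub (a : C(EReal, ℂ)) {l : Filter ℝ}
    [l.IsCountablyGenerated] {s : EReal}
    (hs : ∀ x : ℝ, Tendsto (fun t : ℝ => ((x + t : ℝ) : EReal)) l (𝓝 s)) (u : L2R) :
    Tendsto (fun t => ‖mulHom a (translation t u) - a s • translation t u‖) l (𝓝 0) := by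
  have h1 : ∀ t, ‖mulHom a (translation t u) - a s • translation t u‖ ^ 2
      = ∫ x : ℝ, ‖a ((x + t : ℝ) : EReal) - a s‖ ^ 2 * ‖u x‖ ^ 2 := fun t => by
    rw [norm_sq_eq_integral]
    rw [← integral_add_right_eq_self (fun x => ‖(mulHom a (translation t u) - a s • translation t u : L2R) x‖ ^ 2) t]
    have hq : Measure.QuasiMeasurePreserving (fun x : ℝ => x + t) volume volume :=
      (measurePreserving_add_right volume t).quasiMeasurePreserving
    refine integral_congr_ae ?_
    filter_upwards [hq.ae (Lp.coeFn_sub (mulHom a (translation t u)) (a s • translation t u)),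
      hq.ae (mulHom_apply_ae a (translation t u)), hq.ae (Lp.coeFn_smul (a s) (translation t u)),
      hq.ae (translation_ae t u)] with x h1 h2 h3 h4
    rw [h1, Pi.sub_apply, h2, h3, Pi.smul_apply, h4, smul_eq_mul, ← sub_mul, norm_mul, mul_pow,
      add_sub_cancel_right]
  have hu : Integrable (fun x => ‖u x‖ ^ 2) volume := (Lp.memLp u).integrable_norm_pow two_ne_zero
  have h2 : Tendsto (fun t => ∫ x : ℝ, ‖a ((x + t : ℝ) : EReal) - a s‖ ^ 2 * ‖u x‖ ^ 2) l
      (𝓝 (∫ x : ℝ, 0)) := by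
    refine tendsto_integral_filter_of_dominated_convergence
      (fun x => (‖a‖ + ‖a‖) ^ 2 * ‖u x‖ ^ 2) (Eventually.of_forall fun t => ?_)
      (Eventually.of_forall fun t => Eventually.of_forall fun x => ?_) (hu.const_mul _)
      (Eventually.of_forall fun x => ?_)
    · refine AEStronglyMeasurable.mul ?_ hu.aestronglyMeasurable
      have : Continuous fun x : ℝ => ‖a ((x + t : ℝ) : EReal) - a s‖ ^ 2 :=
        (((a.continuous.comp (continuous_coe_real_ereal.comp (continuous_add_const t))).sub
          continuous_const).norm).pow 2
      exact this.aestronglyMeasurable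
    · rw [Real.norm_of_nonneg (by positivity)]
      gcongr
      exact (norm_sub_le _ _).trans (add_le_add (a.norm_coe_le_norm _) (a.norm_coe_le_norm _))
    · have h3 : Tendsto (fun t : ℝ => a ((x + t : ℝ) : EReal) - a s) l (𝓝 0) := by
        simpa using ((a.continuous.tendsto s).comp (hs x)).sub_const (a s)
      simpa using (h3.norm.pow 2).mul_const (‖u x‖ ^ 2)
  rw [integral_zero] at h2
  have h4 := h2.sqrt
  rw [Real.sqrt_zero] at h4
  refine h4.congr fun t => ?_
  rw [← h1, Real.sqrt_sq (norm_nonneg _)]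

/-- The translates $\tau_tu$ tend weakly to $0$, so $a(M)C\tau_tu\to0$ in norm. But
$a(M)C\tau_tu=a(M)\tau_tCu$ is asymptotic to $a(s)\tau_tCu$, of constant norm $|a(s)|\,\|Cu\|$. -/
theorem eq_zero_of_isCompactOperator_mulHom_mul' {a : C(EReal, ℂ)} {C : L2R →L[ℂ] L2R}
    (hC : ∀ t u, C (translation t u) = translation t (C u))
    (h : IsCompactOperator (mulHom a * C : L2R →L[ℂ] L2R)) {l : Filter ℝ} [l.NeBot]
    [l.IsCountablyGenerated] (hl : l ≤ cocompact ℝ) {s : EReal}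
    (hs : ∀ x : ℝ, Tendsto (fun t : ℝ => ((x + t : ℝ) : EReal)) l (𝓝 s)) (has : a s ≠ 0) :
    C = 0 := by
  ext1 u
  have h1 : Tendsto (fun t => (mulHom a * C : L2R →L[ℂ] L2R) (translation t u)) l (𝓝 0) :=
    tendsto_of_isCompactOperator h (C := ‖u‖) (fun t => (LinearIsometry.norm_map _ u).le)
      fun v => (tendsto_inner_translation u v).mono_left hl
  have h2 := tendsto_norm_mulHom_translation_sub a hs (C u)
  have h3 : Tendsto (fun _ : ℝ => ‖a s‖ * ‖C u‖) l (𝓝 0) := by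
    have h4 := h1.norm.add h2
    rw [norm_zero, add_zero] at h4
    refine squeeze_zero (fun _ => by positivity) (fun t => ?_) h4
    rw [mul_apply_eq_comp, hC]
    have h5 : ‖a s‖ * ‖C u‖ = ‖a s • translation t (C u)‖ := by
      rw [norm_smul, LinearIsometry.norm_map]
    rw [h5]
    have h6 := norm_sub_le (mulHom a (translation t (C u)))
      (mulHom a (translation t (C u)) - a s • translation t (C u))
    rwa [sub_sub_cancel] at h6
  have h7 := tendsto_nhds_unique h3 tendsto_const_nhds
  rcases mul_eq_zero.1 h7.symm with h8 | h8
  · exact absurd (norm_eq_zero.1 h8) has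
  · rw [norm_eq_zero.1 h8, zero_apply]

theorem eq_zero_of_isCompactOperator_mulHom_mul {a : C(EReal, ℂ)} {C : L2R →L[ℂ] L2R}
    (hC : ∀ t u, C (translation t u) = translation t (C u))
    (h : IsCompactOperator (mulHom a * C : L2R →L[ℂ] L2R)) {s : EReal} (hs : s = ⊤ ∨ s = ⊥)
    (has : a s ≠ 0) : C = 0 := by
  rcases hs with rfl | rfl
  · exact eq_zero_of_isCompactOperator_mulHom_mul' hC h (l := atTop) atTop_le_cocompact
      (fun x => EReal.tendsto_coe_atTop.comp (tendsto_atTop_add_const_left _ x tendsto_id)) has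
  · exact eq_zero_of_isCompactOperator_mulHom_mul' hC h (l := atBot) atBot_le_cocompact
      (fun x => EReal.tendsto_coe_atBot.comp (tendsto_atBot_add_const_left _ x tendsto_id)) has

theorem mulHom_modulation (f : C(EReal, ℂ)) (t : ℝ) (u : L2R) :
    mulHom f (modulation t u) = modulation t (mulHom f u) := by
  have e : ∀ x : ℝ, f x * (Complex.exp (Complex.I * t * x) * u x)
      = Complex.exp (Complex.I * t * x) * (f x * u x) := fun x => by ring
  refine Lp.ext ?_
  filter_upwards [mulHom_apply_ae f (modulation t u), modulation_ae t u,
    modulation_ae t (mulHom f u), mulHom_apply_ae f u] with x h1 h2 h3 h4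
  rw [h1, h2, h3, h4, e]

/-- Applying the operator to a bump equal to $1$ at $y$ gives a continuous function vanishing almost
everywhere, hence at $y$. -/
theorem mulHom_injective : Function.Injective mulHom := by
  refine (injective_iff_map_eq_zero _).2 fun f hf => eq_of_eq_coe fun y => ?_
  let φ : ContDiffBump y := ⟨1, 2, one_pos, one_lt_two⟩
  have hφ : Continuous fun x => ((φ x : ℝ) : ℂ) := Complex.continuous_ofReal.comp φ.continuous
  have h2 : MemLp (fun x => ((φ x : ℝ) : ℂ)) 2 volume :=
    hφ.memLp_of_hasCompactSupport (φ.hasCompactSupport.comp_left Complex.ofReal_zero)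
  have h3 : (fun x : ℝ => f x * ((φ x : ℝ) : ℂ)) =ᵐ[volume] fun _ => 0 := by
    have h4 := mulHom_apply_ae f h2.toLp
    rw [hf, zero_apply] at h4
    filter_upwards [h4, h2.coeFn_toLp, Lp.coeFn_zero ℂ 2 volume] with x h5 h6 h7
    rw [← h6, ← h5, h7, Pi.zero_apply]
  have h8 := congr_fun ((Continuous.ae_eq_iff_eq volume
    ((continuous_coe_real f).mul hφ) continuous_const).1 h3) y
  have h9 : φ y = 1 := φ.one_of_mem_closedBall (by simp [φ.rIn_pos.le])
  simpa [h9] using h8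

theorem fourHom_translation (b : C(EReal, ℂ)) (t : ℝ) (u : L2R) :
    fourHom b (translation t u) = translation t (fourHom b u) := by
  refine fourier.injective ?_
  rw [fourier_fourHom_apply, fourier_translation, fourier_translation, mulHom_modulation,
    fourier_fourHom_apply]

/-- Conjugation by $F$ turns translations into modulations, and these commute with multiplication
operators. -/
theorem fourierConj_symm_mulHom_translation (a : C(EReal, ℂ)) (t : ℝ) (u : L2R) :
    fourierConj.symm (mulHom a) (translation t u)
      = translation t (fourierConj.symm (mulHom a) u) := by
  have h : ∀ v, fourierConj.symm (mulHom a) v = fourier (mulHom a (fourier.symm v)) :=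
    fun v => rfl
  obtain ⟨v, rfl⟩ := fourier.surjective u
  rw [translation_fourier, h, h, LinearIsometryEquiv.symm_apply_apply,
    LinearIsometryEquiv.symm_apply_apply, translation_fourier, mulHom_modulation]

/-- If `a(M) b(D)` is compact and `a` does not vanish at `+∞` or at `-∞`, then `b = 0`. -/
theorem eq_zero_right_of_isCompactOperator {a b : C(EReal, ℂ)}
    (h : IsCompactOperator (mulHom a * fourHom b : L2R →L[ℂ] L2R)) {s : EReal}
    (hs : s = ⊤ ∨ s = ⊥) (has : a s ≠ 0) : b = 0 := by
  have h1 := eq_zero_of_isCompactOperator_mulHom_mul (fourHom_translation b) h hs has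
  have h2 : fourierConj (mulHom b) = 0 := h1
  rw [EmbeddingLike.map_eq_zero_iff] at h2
  exact mulHom_injective (h2.trans (map_zero _).symm)

/-- If `a(M) b(D)` is compact and `b` does not vanish at `+∞` or at `-∞`, then `a = 0`. -/
theorem eq_zero_left_of_isCompactOperator {a b : C(EReal, ℂ)}
    (h : IsCompactOperator (mulHom a * fourHom b : L2R →L[ℂ] L2R)) {s : EReal}
    (hs : s = ⊤ ∨ s = ⊥) (hbs : b s ≠ 0) : a = 0 := by
  -- Taking the adjoint and conjugating by $F$ exchanges the roles: $F(a(M)b(D))^*F^{-1}=\bar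
  -- b(M)\cdot F\bar a(M)F^{-1}$, whose second factor commutes with translations.
  have h1 : IsCompactOperator (fourierConj.symm (star (mulHom a * fourHom b : L2R →L[ℂ] L2R))
      : L2R →L[ℂ] L2R) :=
    ((isCompactOperator_star h).comp_clm
      (fourier.symm.toContinuousLinearEquiv : L2R →L[ℂ] L2R)).clm_comp
      (fourier.toContinuousLinearEquiv : L2R →L[ℂ] L2R)
  have h2 : fourierConj.symm (star (mulHom a * fourHom b : L2R →L[ℂ] L2R))
      = mulHom (star b) * fourierConj.symm (mulHom (star a)) := by
    rw [star_mul, map_mul, ← map_star, ← map_star, show fourHom (star b)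
      = fourierConj (mulHom (star b)) from rfl, StarAlgEquiv.symm_apply_apply]
  rw [h2] at h1
  have h3 := eq_zero_of_isCompactOperator_mulHom_mul (fourierConj_symm_mulHom_translation _) h1 hs
    (star_ne_zero.2 hbs)
  rw [EmbeddingLike.map_eq_zero_iff] at h3
  exact star_eq_zero.1 (mulHom_injective (h3.trans (map_zero _).symm))

end SymbolValues

end SymbolAlgebra

namespace SymbolAlgebra

section QuotientNorm

/-! ### The quotient by the compact operators as a commutative C*-algebra -/

/-- Choose a nearly minimal lift $m$ of the class of $a^*a$ and a finite-dimensional projection $P$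
with $(a^*a-m)(1-P)$ small. Then $\|a(1-P)\|^2\le\|a^*a(1-P)\|\le\|m\|+\varepsilon/2$, and $a(1-P)$
is a lift of the class of $a$ because $P$ belongs to the algebra. The ideal is a variable so that
the result applies directly to the commutator ideal. -/
theorem norm_mk_mul_norm_mk_le {I : Ideal algC} [I.IsTwoSided] (hI : I = compactIdeal) (a : algC) :
    ‖Ideal.Quotient.mk I a‖ * ‖Ideal.Quotient.mk I a‖ ≤ ‖Ideal.Quotient.mk I (star a * a)‖ := by
  subst hI
  refine le_of_forall_pos_le_add fun ε hε => ?_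
  obtain ⟨m, hm, hmn⟩ := Submodule.Quotient.norm_mk_lt
    (Ideal.Quotient.mk compactIdeal (star a * a)) (half_pos hε)
  have hk : star a * a - m ∈ compactIdeal := Ideal.Quotient.eq.1 hm.symm
  obtain ⟨V, hV, hVε⟩ := exists_norm_sub_comp_starProjection_le
    (T := ((star a * a - m : algC) : L2R →L[ℂ] L2R)) hk (half_pos hε)
  obtain ⟨P, hP, hPV⟩ := exists_coe_eq_of_isCompactOperator (isCompactOperator_starProjection V)
  have hP' : P ∈ compactIdeal := commutatorIdeal_le_compactIdeal hP
  have h1 : ‖Ideal.Quotient.mk compactIdeal a‖ ≤ ‖a - a * P‖ := by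
    have : Ideal.Quotient.mk compactIdeal a = Ideal.Quotient.mk compactIdeal (a - a * P) :=
      Ideal.Quotient.eq.2 (by rw [sub_sub_cancel]; exact compactIdeal.mul_mem_left a hP')
    rw [this]
    exact Submodule.Quotient.norm_mk_le compactIdeal (a - a * P)
  have h2 := norm_sub_comp_starProjection_sq_le (a : L2R →L[ℂ] L2R) V
  rw [← hPV] at h2 hVε
  have h3 : ‖a - a * P‖ ^ 2 ≤ ‖star a * a - star a * a * P‖ := h2
  have h4 : ‖(star a * a - m) - (star a * a - m) * P‖ ≤ ε / 2 := hVε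
  have h5 : ‖m - m * P‖ ≤ ‖m‖ := by
    have e : ((m - m * P : algC) : L2R →L[ℂ] L2R) = (m : L2R →L[ℂ] L2R) * Vᗮ.starProjection := by
      rw [Submodule.starProjection_orthogonal', mul_sub, mul_one, ← hPV]
      rfl
    change ‖((m - m * P : algC) : L2R →L[ℂ] L2R)‖ ≤ ‖(m : L2R →L[ℂ] L2R)‖
    rw [e]
    refine (norm_mul_le _ _).trans ?_
    exact mul_le_of_le_one_right (norm_nonneg _) (Submodule.starProjection_norm_le _)
  have h6 : star a * a - star a * a * P
      = ((star a * a - m) - (star a * a - m) * P) + (m - m * P) := by noncomm_ring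
  have h7 : ‖star a * a - star a * a * P‖ ≤ ε / 2 + ‖m‖ := by
    rw [h6]
    exact (norm_add_le _ _).trans (add_le_add h4 h5)
  calc ‖Ideal.Quotient.mk compactIdeal a‖ * ‖Ideal.Quotient.mk compactIdeal a‖
      ≤ ‖a - a * P‖ * ‖a - a * P‖ := by gcongr
    _ = ‖a - a * P‖ ^ 2 := (sq _).symm
    _ ≤ ε / 2 + ‖m‖ := h3.trans h7
    _ ≤ ‖Ideal.Quotient.mk compactIdeal (star a * a)‖ + ε := by linarith

instance commutatorIdeal_isStarIdeal : IsStarIdeal (commutatorIdeal algC) := by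
  rw [commutatorIdeal_eq_compactIdeal]
  infer_instance

/-- The quotient of the algebra by its commutator ideal as a commutative C*-algebra. -/
abbrev commCStarAlgebraQuotient : CommCStarAlgebra (algC ⧸ commutatorIdeal algC) :=
  letI : CStarAlgebra algC := StarSubalgebra.cstarAlgebra algC (h_closed := isClosed_algC)
  quotientCommCStarAlgebra (commutatorIdeal algC) (isClosed_commutatorIdeal algC)
    commutator_mem_commutatorIdeal (norm_mk_mul_norm_mk_le commutatorIdeal_eq_compactIdeal)

instance compactSpace_symbolSpace : CompactSpace (SymbolSpace algC) :=
  let _ := commCStarAlgebraQuotient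
  inferInstanceAs (CompactSpace (characterSpace ℂ (algC ⧸ commutatorIdeal algC)))

/-- The Gelfand transform of the quotient by the commutator ideal. -/
def gelfandEquiv : (algC ⧸ commutatorIdeal algC) ≃⋆ₐ[ℂ] C(SymbolSpace algC, ℂ) :=
  letI := commCStarAlgebraQuotient
  gelfandStarTransform (algC ⧸ commutatorIdeal algC)

theorem norm_gelfandEquiv (q : algC ⧸ commutatorIdeal algC) : ‖gelfandEquiv q‖ = ‖q‖ :=
  let _ := commCStarAlgebraQuotient
  (AddMonoidHomClass.isometry_iff_norm _).1
    (gelfandTransform_isometry (algC ⧸ commutatorIdeal algC)) q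

theorem gelfandEquiv_mk (T : algC) :
    gelfandEquiv (Ideal.Quotient.mk (commutatorIdeal algC) T) = symbol T := rfl

/-- The projection onto the quotient by the commutator ideal. -/
def quotientStarHom : algC →⋆ₐ[ℂ] algC ⧸ commutatorIdeal algC :=
  { Ideal.Quotient.mkₐ ℂ (commutatorIdeal algC) with map_star' := fun _ => rfl }

/-- The symbol as a representation. -/
def symbolHom : algC →⋆ₐ[ℂ] C(SymbolSpace algC, ℂ) :=
  (gelfandEquiv : (algC ⧸ commutatorIdeal algC) →⋆ₐ[ℂ] C(SymbolSpace algC, ℂ)).comp quotientStarHom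

theorem symbol_mul (S T : algC) : symbol (S * T) = symbol S * symbol T :=
  map_mul symbolHom S T

/-- This is the bridge between symbols and operators: the Gelfand transform is injective on the
quotient, and the ideal consists of the compact operators. -/
theorem symbol_eq_zero_iff {T : algC} :
    symbol T = 0 ↔ IsCompactOperator (T : L2R →L[ℂ] L2R) := by
  rw [← gelfandEquiv_mk, map_eq_zero_iff gelfandEquiv gelfandEquiv.injective,
    Ideal.Quotient.eq_zero_iff_mem, commutatorIdeal_eq_compactIdeal, mem_compactIdeal]

end QuotientNorm

/-! ### Identification of the symbol space with $M_C$ -/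

section SymbolSpace

theorem mem_MC_iff {p : EReal × EReal} :
    p ∈ MC ↔ (p.1 = ⊤ ∨ p.1 = ⊥) ∨ (p.2 = ⊤ ∨ p.2 = ⊥) := by
  simp only [MC, Set.mem_ofPred_eq, ENNReal.add_eq_top, EReal_abs_eq_top]

theorem exists_eq_one_of_notMem {F : Set EReal} (hF : IsClosed F) {y : EReal} (hy : y ∉ F) :
    ∃ f : C(EReal, ℂ), f y = 1 ∧ ∀ x ∈ F, f x = 0 := by
  obtain ⟨f, hf0, hf1, -⟩ := exists_continuous_zero_one_of_isClosed
    hF (isClosed_singleton (x := y)) (Set.disjoint_singleton_right.2 hy)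
  refine ⟨⟨fun x => (f x : ℂ), by fun_prop⟩, ?_, fun x hx => ?_⟩
  · simp [hf1 (x := y) (by simp)]
  · simp [hf0 (x := x) hx]

/-- If both coordinates were finite, Urysohn functions vanishing at $\pm\infty$ and equal to $1$ at
$x$ and at $\xi$ would contradict the hypothesis. -/
theorem mem_MC_of_mul_eq_zero {x ξ : EReal} (h : ∀ a b : C(EReal, ℂ), a ⊤ = 0 → a ⊥ = 0 →
    b ⊤ = 0 → b ⊥ = 0 → a x * b ξ = 0) : (x, ξ) ∈ MC := by
  by_contra hmem
  rw [mem_MC_iff, not_or] at hmem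
  have hF : IsClosed ({⊤, ⊥} : Set EReal) := (Set.toFinite _).isClosed
  obtain ⟨a, hax, ha⟩ := exists_eq_one_of_notMem hF (y := x) hmem.1
  obtain ⟨b, hbx, hb⟩ := exists_eq_one_of_notMem hF (y := ξ) hmem.2
  have h2 := h a b (ha _ (by simp)) (ha _ (by simp)) (hb _ (by simp)) (hb _ (by simp))
  rw [hax, hbx, mul_one] at h2
  exact one_ne_zero h2

/-! ### The symbol space -/

/-- The representation of `C([-∞, ∞])` by multiplication operators, with values in the algebra. -/
def multAlg : C(EReal, ℂ) →⋆ₐ[ℂ] algC :=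
  StarAlgHom.codRestrict mulHom algC fun f => (multC (CS.ofC f)).2

/-- The representation of `C([-∞, ∞])` by Fourier multipliers, with values in the algebra. -/
def fourAlg : C(EReal, ℂ) →⋆ₐ[ℂ] algC :=
  StarAlgHom.codRestrict fourHom algC fun f => (fourC (CS.ofC f)).2

theorem multAlg_toC (a : CS) : multAlg (CS.toC a) = multC a := rfl

theorem fourAlg_toC (a : CS) : fourAlg (CS.toC a) = fourC a := rfl

/-- The point of `[-∞, ∞]` which corresponds to the character `χ ∘ π` of `C([-∞, ∞])`. -/
def symbolPoint (π : C(EReal, ℂ) →⋆ₐ[ℂ] algC) : C(SymbolSpace algC, EReal) :=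
  letI := commCStarAlgebraQuotient
  ⟨fun χ => (CharacterSpace.homeoEval EReal ℂ).symm
      (CharacterSpace.compContinuousMap (quotientStarHom.comp π) χ),
    (CharacterSpace.homeoEval EReal ℂ).symm.continuous.comp (ContinuousMap.continuous _)⟩

/-- Pulled back along `π`, a character of the quotient becomes one of $C([-\infty,\infty])$, that
is, a point evaluation. -/
theorem symbol_apply_eq (π : C(EReal, ℂ) →⋆ₐ[ℂ] algC) (f : C(EReal, ℂ)) (χ : SymbolSpace algC) :
    symbol (π f) χ = f (symbolPoint π χ) := by
  let _ := commCStarAlgebraQuotient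
  have h := (CharacterSpace.homeoEval EReal ℂ).apply_symm_apply
    (CharacterSpace.compContinuousMap (quotientStarHom.comp π) χ)
  exact (congr_arg (fun φ : characterSpace ℂ C(EReal, ℂ) => φ f) h).symm

theorem symbol_multAlg_mul_fourAlg (a b : C(EReal, ℂ)) (χ : SymbolSpace algC) :
    symbol (multAlg a * fourAlg b) χ = a (symbolPoint multAlg χ) * b (symbolPoint fourAlg χ) :=
  (congr_arg (fun f => f χ) (symbol_mul (multAlg a) (fourAlg b))).trans
    (congr_arg₂ (· * ·) (symbol_apply_eq multAlg a χ) (symbol_apply_eq fourAlg b χ))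

theorem symbolPoint_mem_MC (χ : SymbolSpace algC) :
    (symbolPoint multAlg χ, symbolPoint fourAlg χ) ∈ MC :=
  mem_MC_of_mul_eq_zero fun a b ha1 ha2 hb1 hb2 => by
    have h1 : symbol (multAlg a * fourAlg b) = 0 :=
      symbol_eq_zero_iff.2 (isCompactOperator_mulHom_mul_fourHom ha1 ha2 hb1 hb2)
    rw [← symbol_multAlg_mul_fourAlg, h1, ContinuousMap.zero_apply]

/-- The map from the symbol space to `MC`. -/
def symbolMap : C(SymbolSpace algC, MC) :=
  ⟨fun χ => ⟨(symbolPoint multAlg χ, symbolPoint fourAlg χ), symbolPoint_mem_MC χ⟩, by fun_prop⟩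

/-- Evaluation of the symbols at a point of the symbol space. -/
def symbolEval (χ : SymbolSpace algC) : algC →⋆ₐ[ℂ] ℂ :=
  (ContinuousMap.evalStarAlgHom ℂ ℂ χ).comp symbolHom

theorem symbolEval_apply_eq (π : C(EReal, ℂ) →⋆ₐ[ℂ] algC) (f : C(EReal, ℂ))
    (χ : SymbolSpace algC) : symbolEval χ (π f) = f (symbolPoint π χ) :=
  symbol_apply_eq π f χ

theorem continuous_symbolEval (χ : SymbolSpace algC) : Continuous (symbolEval χ) := by
  have h1 : Continuous (Ideal.Quotient.mk (commutatorIdeal algC)) := continuous_quot_mk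
  exact (map_continuous χ).comp h1

/-- The two coordinates fix a character on the generators, hence by continuity on the closed algebra
they generate. -/
theorem injective_symbolMap : Function.Injective symbolMap := by
  intro χ₁ χ₂ h
  have hp : (symbolPoint multAlg χ₁, symbolPoint fourAlg χ₁)
      = (symbolPoint multAlg χ₂, symbolPoint fourAlg χ₂) := congr_arg Subtype.val h
  obtain ⟨hx, hξ⟩ := Prod.mk.inj hp
  have h1 : ∀ π : C(EReal, ℂ) →⋆ₐ[ℂ] algC, symbolPoint π χ₁ = symbolPoint π χ₂ →
      ∀ f, symbolEval χ₁ (π f) = symbolEval χ₂ (π f) := fun π hπ f => by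
    rw [symbolEval_apply_eq, symbolEval_apply_eq, hπ]
  have key : symbolEval χ₁ = symbolEval χ₂ := by
    refine StarAlgHom.ext_topologicalClosure (continuous_symbolEval χ₁) (continuous_symbolEval χ₂)
      (StarAlgHom.ext_adjoin fun T hT => ?_)
    rcases hT with ⟨a, ha⟩ | ⟨b, hb⟩
    · have e : StarSubalgebra.inclusion (StarSubalgebra.le_topologicalClosure _) T
          = multAlg (CS.toC a) := Subtype.ext ha.symm
      exact (congr_arg (symbolEval χ₁) e).trans
        ((h1 multAlg hx _).trans (congr_arg (symbolEval χ₂) e).symm)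
    · have e : StarSubalgebra.inclusion (StarSubalgebra.le_topologicalClosure _) T
          = fourAlg (CS.toC b) := Subtype.ext hb.symm
      exact (congr_arg (symbolEval χ₁) e).trans
        ((h1 fourAlg hξ _).trans (congr_arg (symbolEval χ₂) e).symm)
  refine CharacterSpace.ext fun q => ?_
  obtain ⟨T, rfl⟩ := Ideal.Quotient.mk_surjective q
  exact congr_arg (fun φ : algC →⋆ₐ[ℂ] ℂ => φ T) key

/-- The image is compact, so a missed point has a box neighbourhood $U\times V$ disjoint from it.
Functions $a$, $b$ vanishing off $U$, $V$ and equal to $1$ at the coordinates of the point give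
$a(M)b(D)$ zero symbol, so it is compact. One coordinate is infinite, which forces the function of
the other coordinate to vanish identically. -/
theorem surjective_symbolMap : Function.Surjective symbolMap := by
  by_contra hs
  obtain ⟨p, hp⟩ := not_forall.1 hs
  let Q : SymbolSpace algC → EReal × EReal := fun χ => (symbolMap χ : EReal × EReal)
  have hQ : Continuous Q := continuous_subtype_val.comp symbolMap.continuous
  have hK : IsClosed (Set.range Q) := (isCompact_range hQ).isClosed
  have hpQ : (p : EReal × EReal) ∈ (Set.range Q)ᶜ := by
    rintro ⟨χ, hχ⟩
    exact hp ⟨χ, Subtype.ext hχ⟩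
  obtain ⟨U, V, hU, hV, hpU, hpV, hUV⟩ := isOpen_prod_iff.1 hK.isOpen_compl _ _ hpQ
  obtain ⟨a, hap, ha⟩ := exists_eq_one_of_notMem hU.isClosed_compl (Set.notMem_compl_iff.2 hpU)
  obtain ⟨b, hbp, hb⟩ := exists_eq_one_of_notMem hV.isClosed_compl (Set.notMem_compl_iff.2 hpV)
  have h1 : symbol (multAlg a * fourAlg b) = 0 := by
    refine ContinuousMap.ext fun χ => ?_
    rw [ContinuousMap.zero_apply, symbol_multAlg_mul_fourAlg]
    by_cases hx : symbolPoint multAlg χ ∈ U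
    · by_cases hξ : symbolPoint fourAlg χ ∈ V
      · exact absurd ⟨χ, rfl⟩ (hUV (Set.mk_mem_prod hx hξ))
      · rw [hb _ hξ, mul_zero]
    · rw [ha _ hx, zero_mul]
  have h2 : IsCompactOperator (mulHom a * fourHom b : L2R →L[ℂ] L2R) := symbol_eq_zero_iff.1 h1
  rcases mem_MC_iff.1 p.2 with h3 | h3
  · have h4 := eq_zero_right_of_isCompactOperator h2 h3 (by rw [hap]; exact one_ne_zero)
    rw [h4, ContinuousMap.zero_apply] at hbp
    exact zero_ne_one hbp
  · have h4 := eq_zero_left_of_isCompactOperator h2 h3 (by rw [hbp]; exact one_ne_zero)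
    rw [h4, ContinuousMap.zero_apply] at hap
    exact zero_ne_one hap

/-- The homeomorphism between the symbol space and `MC`. -/
def symbolHomeo : SymbolSpace algC ≃ₜ MC :=
  Continuous.homeoOfEquivCompactToT2
    (f := Equiv.ofBijective symbolMap ⟨injective_symbolMap, surjective_symbolMap⟩)
    symbolMap.continuous

theorem symbolMap_symbolHomeo_symm (p : MC) : symbolMap (symbolHomeo.symm p) = p :=
  symbolHomeo.apply_symm_apply p

theorem symbol_multC (a : CS) (p : MC) :
    symbol (multC a) (symbolHomeo.symm p) = CS.ext a p.1.1 := by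
  rw [← multAlg_toC, symbol_apply_eq]
  exact congr_arg (fun q : MC => CS.ext a q.1.1) (symbolMap_symbolHomeo_symm p)

theorem symbol_fourC (b : CS) (p : MC) :
    symbol (fourC b) (symbolHomeo.symm p) = CS.ext b p.1.2 := by
  rw [← fourAlg_toC, symbol_apply_eq]
  exact congr_arg (fun q : MC => CS.ext b q.1.2) (symbolMap_symbolHomeo_symm p)

theorem norm_comp_homeomorph {X Y : Type*} [TopologicalSpace X] [CompactSpace X]
    [TopologicalSpace Y] [CompactSpace Y] (h : X ≃ₜ Y) (f : C(Y, ℂ)) :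
    ‖f.comp (h : C(X, Y))‖ = ‖f‖ := by
  refine le_antisymm ((ContinuousMap.norm_le _ (norm_nonneg _)).2 fun x => f.norm_coe_le_norm _)
    ((ContinuousMap.norm_le _ (norm_nonneg _)).2 fun y => ?_)
  have := (f.comp (h : C(X, Y))).norm_coe_le_norm (h.symm y)
  simpa using this

/-- Stated for a variable ideal, since `compactIdeal` equals the commutator ideal only
propositionally and the quotient types must be transported. -/
theorem exists_quotient_starAlgEquiv {I : Ideal algC} [I.IsTwoSided] [IsStarIdeal I]
    (hI : I = commutatorIdeal algC) :
    ∃ Φ : (algC ⧸ I) ≃⋆ₐ[ℂ] C(MC, ℂ), (∀ q, ‖Φ q‖ = ‖q‖) ∧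
      ∀ (T : algC) (p : MC),
        Φ (Ideal.Quotient.mk I T) p = symbol T (symbolHomeo.symm p) := by
  subst hI
  exact ⟨gelfandEquiv.trans (symbolHomeo.symm.compStarAlgEquiv' ℂ ℂ),
    fun q => (norm_comp_homeomorph symbolHomeo.symm (gelfandEquiv q)).trans (norm_gelfandEquiv q),
    fun T p => rfl⟩

end SymbolSpace

end SymbolAlgebra

end

theorem mainTheorem7 :
    ((↑) : algC → (L2R →L[ℂ] L2R)) ''
        (commutatorIdeal algC : Set algC)
      = {T : L2R →L[ℂ] L2R | IsCompactOperator T} ∧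
    ∃ h : SymbolSpace algC ≃ₜ MC,
      (∀ (a : CS) (p : MC),
        symbol (multC a) (h.symm p)
          = CS.ext a p.1.1) ∧
      (∀ (b : CS) (p : MC),
        symbol (fourC b) (h.symm p)
          = CS.ext b p.1.2) ∧
      ∃ Φ : (algC ⧸ compactIdeal) ≃⋆ₐ[ℂ] C(MC, ℂ),
        (∀ q, ‖Φ q‖ = ‖q‖) ∧
        ∀ (T : algC) (p : MC),
          Φ (Ideal.Quotient.mk compactIdeal T) p
            = symbol T (h.symm p) := by
  exact ⟨image_commutatorIdeal, symbolHomeo, symbol_multC, symbol_fourC,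
    exists_quotient_starAlgEquiv commutatorIdeal_eq_compactIdeal.symm⟩
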